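/- Let $K$ be a field of characteristic $0$. (1) Let $\mathfrak g=\bigoplus_{p\in\mathbb Z}\mathfrak g_p$ be a finite-dimensional $\mathbb Z$-graded Lie algebra over $K$ (so $[\mathfrak g_p,\mathfrak g_q]\subseteq\mathfrak g_{p+q}$), with solvable radical $\mathfrak r$. Then $\mathfrak g$ has a $\mathbb Z$-graded Levi–Malcev decomposition: there is a semisimple Lie subalgebra $\mathfrak s\subseteq\mathfrak g$ such that $\mathfrak g=\mathfrak s\oplus\mathfrak r$ as vector spaces and both $\mathfrak s$ and $\mathfrak r$ are graded subspaces, i.e. $\mathfrak s=\bigoplus_p(\mathfrak s\cap\mathfrak g_p)$ and $\mathfrak r=\bigoplus_p(\mathfrak r\cap\mathfrak g_p)$. (2) Let $V=\bigoplus_{q\in\mathbb Z}V_q$ be a finite-dimensional $\mathbb Z$-graded $K$-vector space, and give $\mathfrak{gl}(V)$ the grading $\mathfrak{gl}(V)_p=\{A\mid A(V_q)\subseteq V_{q+p}\ \text{for all } q\in\mathbb Z\}$. Let $\mathfrak g\subseteq\mathfrak{gl}(V)$ be a graded Lie subalgebra that is decomposable in $V$, i.e. $\mathfrak g$ equals the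 Lie subalgebra of $\mathfrak{gl}(V)$ generated by the semisimple and nilpotent Jordan–Chevalley components of all elements of $\mathfrak g$. Let $\mathfrak n_V$ be the set of those elements of the solvable radical of $\mathfrak g$ that are nilpotent endomorphisms of $V$. Then $\mathfrak n_V$ is an ideal of $\mathfrak g$, and $\mathfrak g$ has a $\mathbb Z$-graded Levi–Chevalley decomposition in $V$: there is a Lie subalgebra $\mathfrak l_V\subseteq\mathfrak g$ such that $V$ is a completely reducible $\mathfrak l_V$-module, $\mathfrak g=\mathfrak l_V\oplus\mathfrak n_V$ as vector spaces, and both $\mathfrak l_V$ and $\mathfrak n_V$ are graded subspaces of $\mathfrak{gl}(V)$. -/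

import Mathlib

-- The commutator bracket on endomorphism rings.
attribute [local instance 100] LieRing.ofAssociativeRing

namespace GradedLevi

section

variable {K : Type*} [Field K] {V : Type*} [AddCommGroup V] [Module K V]

/-- The endomorphisms of `V` that are homogeneous of degree `p` with respect to a `ℤ`-gradation
`𝒱` of `V`. -/
def glGrading (𝒱 : ℤ → Submodule K V) (p : ℤ) : Submodule K (Module.End K V) where
  carrier := {A | ∀ q : ℤ, ∀ v ∈ 𝒱 q, A v ∈ 𝒱 (q + p)}
  add_mem' hA hB q v hv := add_mem (hA q v hv) (hB q v hv)
  zero_mem' q _ _ := zero_mem (𝒱 (q + p))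
  smul_mem' c _ hA q v hv := Submodule.smul_mem _ c (hA q v hv)

/-- The projection of `V` onto its homogeneous summand of degree `q`. -/
def gradedProj (𝒱 : ℤ → Submodule K V) [DirectSum.Decomposition 𝒱] (q : ℤ) : Module.End K V where
  toFun v := (DirectSum.decompose 𝒱 v q : V)
  map_add' v w := by simp
  map_smul' c v := by
    rw [DirectSum.decompose_smul]; rfl

theorem isInternal_glGrading [FiniteDimensional K V] (𝒱 : ℤ → Submodule K V)
    [DirectSum.Decomposition 𝒱] : DirectSum.IsInternal (glGrading 𝒱) := by
  classical
  have hint := DirectSum.Decomposition.isInternal 𝒱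
  have hspan : iSup 𝒱 = ⊤ := hint.submodule_iSup_eq_top
  constructor
  · rw [injective_iff_map_eq_zero]
    intro x hx
    ext p : 2
    rw [DirectSum.coeAddMonoidHom_eq_dfinsuppSum, DFinsupp.sum] at hx
    refine LinearMap.ext fun w => ?_
    have hw : w ∈ iSup 𝒱 := hspan ▸ Submodule.mem_top
    induction hw using Submodule.iSup_induction' with
    | zero => simp
    | add a b _ _ ha hb => rw [map_add, map_add, ha, hb]
    | mem q v hv =>
      have h1 : (∑ i ∈ x.support, (x i : Module.End K V)) v = 0 := by rw [hx]; rfl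
      rw [LinearMap.sum_apply] at h1
      have h2 := congrArg (gradedProj 𝒱 (q + p)) h1
      rw [map_sum, map_zero] at h2
      have h3 : ∀ i, gradedProj 𝒱 (q + p) ((x i : Module.End K V) v)
          = if i = p then (x p : Module.End K V) v else 0 := by
        intro i
        have hi := (x i).2 q v hv
        split_ifs with h
        · subst h
          exact DirectSum.decompose_of_mem_same 𝒱 hi
        · exact DirectSum.decompose_of_mem_ne 𝒱 hi (by omega)
      simp only [h3, Finset.sum_ite_eq'] at h2
      by_cases hp : p ∈ x.support
      · simpa [hp] using h2
      · have : x p = 0 := by simpa using hp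
        simp [this]
  · have hfin : {q | 𝒱 q ≠ ⊥}.Finite :=
      WellFoundedGT.finite_ne_bot_of_iSupIndep hint.submodule_iSupIndep
    have hsum : ∀ v, ∑ q ∈ hfin.toFinset, gradedProj 𝒱 q v = v := by
      intro v
      conv_rhs => rw [← DirectSum.sum_support_decompose 𝒱 v]
      symm
      refine Finset.sum_subset (fun q hq => ?_) (fun q _ hq => ?_)
      · rw [Set.Finite.mem_toFinset, Set.mem_ofPred_eq]
        intro h0
        have h4 : DirectSum.decompose 𝒱 v q ≠ 0 := by simpa using hq
        exact h4 (Subtype.ext ((Submodule.mem_bot K).1 (h0 ▸ (DirectSum.decompose 𝒱 v q).2)))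
      · have h4 : DirectSum.decompose 𝒱 v q = 0 := by simpa using hq
        simp [h4]
    have htop : iSup (glGrading 𝒱) = ⊤ := by
      refine eq_top_iff.2 fun A _ => ?_
      have hA : A = ∑ q ∈ hfin.toFinset, ∑ r ∈ hfin.toFinset,
          gradedProj 𝒱 r * A * gradedProj 𝒱 q := by
        refine LinearMap.ext fun v => ?_
        simp only [LinearMap.sum_apply, Module.End.mul_apply, hsum]
        rw [← map_sum, hsum]
      rw [hA]
      refine Submodule.sum_mem _ fun q _ => Submodule.sum_mem _ fun r _ => ?_
      refine Submodule.mem_iSup_of_mem (r - q) fun s v hv => ?_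
      by_cases h : s = q
      · subst h
        rw [add_sub_cancel]
        exact (DirectSum.decompose 𝒱 _ r).2
      · have h5 : gradedProj 𝒱 q v = 0 := DirectSum.decompose_of_mem_ne 𝒱 hv h
        simp [h5]
    intro A
    have hA : A ∈ iSup (glGrading 𝒱) := htop ▸ Submodule.mem_top
    obtain ⟨f, hf⟩ := (Submodule.mem_iSup_iff_exists_dfinsupp' _ A).1 hA
    exact ⟨f, by rw [← hf]; exact DirectSum.coeAddMonoidHom_eq_dfinsuppSum _ f⟩

/-- For a finite-dimensional `ℤ`-graded vector space `V`, the Lie algebra `gl(V)` is `ℤ`-graded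
by the degree of endomorphisms. -/
noncomputable instance glGradedLieAlgebra [FiniteDimensional K V] (𝒱 : ℤ → Submodule K V)
    [DirectSum.Decomposition 𝒱] : GradedLieAlgebra (glGrading 𝒱) where
  toDecomposition := (isInternal_glGrading 𝒱).chooseDecomposition
  bracket_mem p r A B hA hB q v hv := by
    rw [Ring.lie_def]
    refine sub_mem ?_ ?_
    · have h := hA _ _ (hB q v hv)
      rwa [add_assoc, add_comm r p] at h
    · have h := hB _ _ (hA q v hv)
      rwa [add_assoc] at h

/-- The decomposable envelope in `V` of a Lie subalgebra `g` of `gl(V)`: the Lie subalgebra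
generated by the semisimple and the nilpotent Jordan-Chevalley components of the elements
of `g`. -/
def decomposableEnvelope (g : LieSubalgebra K (Module.End K V)) :
    LieSubalgebra K (Module.End K V) :=
  LieSubalgebra.lieSpan K (Module.End K V)
    {B | ∃ S N : Module.End K V, S.IsSemisimple ∧ IsNilpotent N ∧ Commute S N ∧ S + N ∈ g ∧
      (B = S ∨ B = N)}

/-- A Lie subalgebra of `gl(V)` is decomposable in `V` if it equals its decomposable envelope. -/
def IsDecomposable (g : LieSubalgebra K (Module.End K V)) : Prop :=
  decomposableEnvelope g = g

/-- `h` is `V`-reductive: `V` is a completely reducible `h`-module. -/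
def IsReductiveIn (h : LieSubalgebra K (Module.End K V)) : Prop :=
  ComplementedLattice (LieSubmodule K h V)

/-- `g = l ⊕ n` is a Levi-Chevalley decomposition of `g ⊆ gl(V)` in `V`: `l` is a `V`-reductive Lie
subalgebra of `g`, and the ideal `n` is the set `n_V` of those elements of the solvable radical
of `g` that are nilpotent endomorphisms of `V`. -/
structure IsLeviChevalley (g : LieSubalgebra K (Module.End K V)) (l : LieSubalgebra K g)
    (n : LieIdeal K g) : Prop where
  reductive : IsReductiveIn (l.map g.incl)
  mem_iff : ∀ X : g, X ∈ n ↔ X ∈ LieAlgebra.radical K g ∧ IsNilpotent (X : Module.End K V)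
  isCompl : IsCompl l.toSubmodule n.toSubmodule

end

/-- `L = s ⊕ r` is a Levi-Malcev decomposition of `L`, where `r` is the solvable radical: `s` is a
semisimple Lie subalgebra complementary to `r`. -/
structure IsLeviMalcev {K : Type*} [Field K] {L : Type*} [LieRing L] [LieAlgebra K L]
    (s : LieSubalgebra K L) : Prop where
  semisimple : LieAlgebra.IsSemisimple K s
  isCompl : IsCompl s.toSubmodule (LieAlgebra.radical K L).toSubmodule

end GradedLevi

/-! In characteristic zero a `ℤ`-grading is encoded by the semisimple operator `D` acting on degree
`p` as the scalar `p`. Its eigenvalues are distinct, so each homogeneous component of a vector is a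
polynomial in `D` applied to that vector, and a subspace is graded exactly when it is `D`-stable. On
a graded Lie algebra `D` is a derivation; on `gl(V)` it is `ad E`, with `E` the degree operator of
`V`. It therefore suffices to prove both decomposition theorems equivariantly for a semisimple
derivation.

One splitting principle does most of the work: if an action preserves `W` and sends `W` into `N`,
every `w ∈ W` becomes invariant after subtracting an element of `W ∩ N`. It holds for commuting
semisimple operators (`exists_mem_inf_forall_apply_sub_eq_zero_of_isSemisimple`) and, through the
Casimir operator, for semisimple Lie algebras (`exists_mem_inf_forall_apply_sub_eq_zero`). With `W`
the endomorphisms into `U` that are scalar on `U`, and `N` those vanishing on `U`, it yields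
equivariant projections onto `U`, hence Weyl's theorem and the Levi splitting.

For a decomposable `g ⊆ gl(V)`, take an `E`-stable Levi subalgebra `s`. Brackets of `g` or `E` with
the radical are nilpotent, so the principle gives `r = c + n`, where `c` is the centralizer of `s`
and `E` in `r` and `n` the nilpotent part. Decomposability makes `c` closed under semisimple parts,
so `c ⊆ t + n` for a maximal torus `t` of `c`. Then `l = s + t` is reductive in `V`, complements
`n`, and is `E`-stable. -/

namespace GradedLevi

/-! ### Splitting principle for commuting semisimple operators -/

section LinearAlgebra

variable {K : Type*} [Field K] {X : Type*} [AddCommGroup X] [Module K X] [FiniteDimensional K X]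

/-- A semisimple endomorphism decomposes every invariant subspace into kernel and image. -/
theorem exists_add_of_isSemisimple {A : Module.End K X} (hA : A.IsSemisimple) {W : Submodule K X}
    (hW : ∀ w ∈ W, A w ∈ W) {w : X} (hw : w ∈ W) :
    ∃ u ∈ W, ∃ v ∈ W, w = u + A v ∧ A u = 0 := by
  have hB := (Module.End.isSemisimple_iff.1 (hA.restrict hW))
  set B := A.restrict hW with hBdef
  obtain ⟨q, hq, hc⟩ := hB (LinearMap.ker B) (by
    intro x hx
    have : B x = 0 := hx
    simp [this])
  have hq' : ∀ x ∈ q, B x ∈ q := hq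
  have hinj : Function.Injective (B.restrict hq') := by
    rw [injective_iff_map_eq_zero]
    rintro ⟨x, hx⟩ h
    have h' : B x = 0 := congrArg Subtype.val h
    have := (Submodule.disjoint_def.1 hc.disjoint) x h' hx
    simpa using this
  have hsurj := LinearMap.injective_iff_surjective.1 hinj
  obtain ⟨y, hy, z, hz, hyz⟩ := Submodule.mem_sup.1 (hc.sup_eq_top ▸ Submodule.mem_top : (⟨w, hw⟩ : W) ∈ _)
  obtain ⟨v, hv⟩ := hsurj ⟨z, hz⟩
  refine ⟨y, y.2, v.1, v.1.2, ?_, congrArg Subtype.val (show B y = 0 from hy)⟩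
  have h1 : B v.1 = z := congrArg Subtype.val hv
  have h2 : A v.1 = z := congrArg Subtype.val h1
  rw [h2]
  exact (congrArg Subtype.val hyz).symm

/-- If a commuting family of semisimple endomorphisms maps an invariant subspace `W` to `N`, then
`W` is the sum of `W ∩ N` and of the vectors of `W` killed by the family. -/
theorem exists_mem_inf_forall_apply_sub_eq_zero_of_isSemisimple (F : Set (Module.End K X))
    (hcomm : ∀ A ∈ F, ∀ B ∈ F, Commute A B) (hss : ∀ A ∈ F, A.IsSemisimple)
    (N W : Submodule K X) (hW : ∀ A ∈ F, ∀ w ∈ W, A w ∈ W) (hN : ∀ A ∈ F, ∀ w ∈ W, A w ∈ N)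
    {w : X} (hw : w ∈ W) : ∃ n ∈ W ⊓ N, ∀ A ∈ F, A (w - n) = 0 := by
  induction hd : Module.finrank K W using Nat.strong_induction_on generalizing W w with
  | _ d ih =>
  subst hd
  by_cases h : ∀ A ∈ F, ∀ w ∈ W, A w = 0
  · exact ⟨0, zero_mem _, fun A hA => by simpa using h A hA w hw⟩
  push Not at h
  obtain ⟨A, hA, x, hx, hAx⟩ := h
  obtain ⟨u, hu, v, hv, rfl, hAu⟩ := exists_add_of_isSemisimple (hss A hA) (hW A hA) hw
  -- The summand `A v` already lies in `W ∩ N`, so only `u` needs correcting; it lies in `W ∩ ker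
  -- A`, which the whole family preserves because it commutes with `A`.
  have hlt : W ⊓ LinearMap.ker A < W := by
    refine lt_of_le_of_ne inf_le_left fun h => hAx ?_
    exact (h.ge hx).2
  obtain ⟨n, hn, hn'⟩ := ih _ (Submodule.finrank_lt_finrank_of_lt hlt) (W ⊓ LinearMap.ker A)
    (fun B hB w hw => ⟨hW B hB w hw.1, by
      have := LinearMap.congr_fun (hcomm A hA B hB).eq w
      simp only [Module.End.mul_apply, LinearMap.mem_ker.1 hw.2, map_zero] at this
      exact this⟩)
    (fun B hB w hw => hN B hB w hw.1) (w := u) ⟨hu, hAu⟩ rfl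
  refine ⟨n + A v, ⟨add_mem hn.1.1 (hW A hA v hv), add_mem hn.2 (hN A hA v hv)⟩, fun B hB => ?_⟩
  rw [add_sub_add_right_eq_sub]
  exact hn' B hB

end LinearAlgebra

/-! ### Solvable extensions, quotients and trivial radicals -/

section Lie

variable {K : Type*} [Field K] {L S T : Type*} [LieRing L] [LieAlgebra K L] [LieRing S]
  [LieAlgebra K S] [LieRing T] [LieAlgebra K T]

theorem isSolvable_of_isSolvable_ker (f : L →ₗ⁅K⁆ S) [LieAlgebra.IsSolvable S]
    [LieAlgebra.IsSolvable f.ker] : LieAlgebra.IsSolvable L := by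
  obtain ⟨k, hk⟩ := LieAlgebra.IsSolvable.solvable K S
  obtain ⟨l, hl⟩ := LieAlgebra.IsSolvable.solvable K f.ker
  have h1 : LieAlgebra.derivedSeries K L k ≤ f.ker := by
    rw [← LieIdeal.map_eq_bot_iff, eq_bot_iff, ← hk]
    exact LieIdeal.derivedSeries_map_le k
  refine LieAlgebra.IsSolvable.mk (R := K) (k := l + k) ?_
  rw [LieAlgebra.derivedSeries_def, LieAlgebra.derivedSeriesOfIdeal_add, eq_bot_iff,
    ← (LieIdeal.derivedSeries_eq_bot_iff f.ker l).1 hl]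
  exact LieAlgebra.derivedSeriesOfIdeal_mono h1 l

/-- A Lie algebra homomorphism factors through a surjective one with smaller kernel. -/
theorem exists_comp_eq_of_ker_le (f : L →ₗ⁅K⁆ S) (hf : Function.Surjective f) (h : L →ₗ⁅K⁆ T)
    (hfh : ∀ x, f x = 0 → h x = 0) : ∃ φ : S →ₗ⁅K⁆ T, ∀ x, φ (f x) = h x := by
  obtain ⟨σ, hσ⟩ := (f : L →ₗ[K] S).exists_rightInverse_of_surjective (LinearMap.range_eq_top.2 hf)
  have hσ' : ∀ s, f (σ s) = s := fun s => LinearMap.congr_fun hσ s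
  have key : ∀ x y, f x = f y → h x = h y := fun x y hxy => by
    rw [← sub_eq_zero, ← map_sub]
    exact hfh _ (by rw [map_sub, hxy, sub_self])
  refine ⟨{ toLinearMap := (h : L →ₗ[K] T) ∘ₗ σ, map_lie' := fun {x y} => ?_ }, fun x => ?_⟩
  · change h (σ ⁅x, y⁆) = ⁅h (σ x), h (σ y)⁆
    rw [← LieHom.map_lie]
    exact key _ _ (by simp [hσ'])
  · exact key _ _ (hσ' _)

/-- The kernel has a Killing-orthogonal complement, on which `φ` is injective. A solvable ideal of
`T` lifts to a solvable ideal inside this complement, which must vanish. -/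
theorem hasTrivialRadical_of_surjective [CharZero K] [FiniteDimensional K S]
    [LieAlgebra.HasTrivialRadical K S] (φ : S →ₗ⁅K⁆ T) (hφ : Function.Surjective φ) :
    LieAlgebra.HasTrivialRadical K T := by
  refine LieAlgebra.hasTrivialRadical_of_no_solvable_ideals fun R hR => ?_
  have hc := LieIdeal.isCompl_killingCompl φ.ker
  set Q : LieIdeal K S := φ.ker.killingCompl ⊓ R.comap φ with hQ
  have hker : ∀ x ∈ Q, φ x = 0 → x = 0 := fun x hx h => by
    have : x ∈ φ.ker ⊓ φ.ker.killingCompl := ⟨h, hx.1⟩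
    rwa [hc.inf_eq_bot] at this
  let ψ : Q →ₗ⁅K⁆ R :=
    { toFun := fun x => ⟨φ x, LieIdeal.mem_comap.1 x.2.2⟩
      map_add' := fun x y => Subtype.ext (by simp)
      map_smul' := fun c x => Subtype.ext (by simp)
      map_lie' := fun {x y} => Subtype.ext (by simp) }
  have hψ : Function.Injective ψ := by
    rw [injective_iff_map_eq_zero]
    intro x hx
    exact Subtype.ext (hker x x.2 (congrArg Subtype.val hx))
  have : LieAlgebra.IsSolvable Q := hψ.lieAlgebra_isSolvable
  have hQ0 : Q = ⊥ := LieAlgebra.HasTrivialRadical.eq_bot_of_isSolvable Q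
  rw [LieSubmodule.eq_bot_iff]
  intro t ht
  obtain ⟨s, rfl⟩ := hφ t
  obtain ⟨y, hy, z, hz, rfl⟩ := (LieSubmodule.mem_sup _ _ _).1
    (hc.sup_eq_top ▸ LieSubmodule.mem_top s : s ∈ φ.ker ⊔ φ.ker.killingCompl)
  have hy0 : φ y = 0 := hy
  rw [map_add, hy0, zero_add] at ht ⊢
  have : z ∈ Q := ⟨hz, LieIdeal.mem_comap.2 ht⟩
  rw [hQ0] at this
  rw [(LieSubmodule.mem_bot z).1 this, map_zero]

theorem hasTrivialRadical_of_surjective_of_ker_le [CharZero K] [FiniteDimensional K S]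
    [LieAlgebra.HasTrivialRadical K S] (f : L →ₗ⁅K⁆ S) (hf : Function.Surjective f)
    (h : L →ₗ⁅K⁆ T) (hh : Function.Surjective h) (hfh : ∀ x, f x = 0 → h x = 0) :
    LieAlgebra.HasTrivialRadical K T := by
  obtain ⟨φ, hφ⟩ := exists_comp_eq_of_ker_le f hf h hfh
  refine hasTrivialRadical_of_surjective φ fun t => ?_
  obtain ⟨x, rfl⟩ := hh t
  exact ⟨f x, hφ x⟩

/-- The quotient homomorphism by an ideal. -/
def quotientHom (I : LieIdeal K L) : L →ₗ⁅K⁆ L ⧸ I :=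
  { (LieSubmodule.Quotient.mk' I : L →ₗ[K] L ⧸ I) with
    map_lie' := fun {x y} => LieSubmodule.Quotient.mk_bracket I x y }

theorem quotientHom_surjective (I : LieIdeal K L) : Function.Surjective (quotientHom I) :=
  LieSubmodule.Quotient.surjective_mk' I

theorem quotientHom_eq_zero (I : LieIdeal K L) (x : L) : quotientHom I x = 0 ↔ x ∈ I :=
  LieSubmodule.Quotient.mk_eq_zero I

theorem ker_quotientHom (I : LieIdeal K L) : (quotientHom I).ker = I := by
  ext x
  exact quotientHom_eq_zero I x

instance hasTrivialRadical_quotient_radical [FiniteDimensional K L] :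
    LieAlgebra.HasTrivialRadical K (L ⧸ LieAlgebra.radical K L) := by
  refine LieAlgebra.hasTrivialRadical_of_no_solvable_ideals fun R hR => ?_
  let I := LieAlgebra.radical K L
  let J := R.comap (quotientHom I)
  let ψ : J →ₗ⁅K⁆ R :=
    { toFun := fun x => ⟨quotientHom I x, LieIdeal.mem_comap.1 x.2⟩
      map_add' := fun x y => Subtype.ext (by simp)
      map_smul' := fun c x => Subtype.ext (by simp)
      map_lie' := fun {x y} => Subtype.ext (by simp) }
  let i : ψ.ker →ₗ⁅K⁆ I :=
    { toFun := fun x => ⟨x, (quotientHom_eq_zero I _).1 (congrArg Subtype.val x.2)⟩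
      map_add' := fun x y => Subtype.ext (by simp)
      map_smul' := fun c x => Subtype.ext (by simp)
      map_lie' := fun {x y} => Subtype.ext (by simp) }
  have hi : Function.Injective i := fun x y h =>
    Subtype.ext (Subtype.ext (congrArg (fun z : I => (z : L)) h))
  have : LieAlgebra.IsSolvable ψ.ker := hi.lieAlgebra_isSolvable
  have : LieAlgebra.IsSolvable J := isSolvable_of_isSolvable_ker ψ
  have hJ : J ≤ I := (LieAlgebra.LieIdeal.solvable_iff_le_radical K L J).1 this
  rw [LieSubmodule.eq_bot_iff]
  intro t ht
  obtain ⟨x, rfl⟩ := quotientHom_surjective I t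
  exact (quotientHom_eq_zero I x).2 (hJ (LieIdeal.mem_comap.2 ht))

/-- A Lie algebra with trivial radical is perfect. -/
theorem lie_top_top_of_hasTrivialRadical [CharZero K] [FiniteDimensional K S]
    [LieAlgebra.HasTrivialRadical K S] : ⁅(⊤ : LieIdeal K S), (⊤ : LieIdeal K S)⁆ = ⊤ := by
  set J := ⁅(⊤ : LieIdeal K S), (⊤ : LieIdeal K S)⁆ with hJ
  have := hasTrivialRadical_of_surjective (quotientHom J) (quotientHom_surjective J)
  have hab : IsLieAbelian (S ⧸ J) := ⟨fun x y => by
    obtain ⟨x, rfl⟩ := quotientHom_surjective J x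
    obtain ⟨y, rfl⟩ := quotientHom_surjective J y
    rw [← LieHom.map_lie, quotientHom_eq_zero]
    exact LieSubmodule.lie_mem_lie (LieSubmodule.mem_top x) (LieSubmodule.mem_top y)⟩
  have := LieAlgebra.subsingleton_of_hasTrivialRadical_lie_abelian K (S ⧸ J)
  rw [eq_top_iff]
  intro x _
  exact (quotientHom_eq_zero J x).1 (Subsingleton.elim _ _)

end Lie

/-! ### Cartan's criterion and the Casimir operator -/

section Casimir

variable {K : Type*} [Field K] {W : Type*} [AddCommGroup W] [Module K W]

/-- Engel's theorem: nilpotent endomorphisms are ad-nilpotent, and injectivity of `ρ` carries this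
back to `g`. -/
theorem isNilpotent_of_injective_of_forall_isNilpotent {g : Type*} [LieRing g] [LieAlgebra K g]
    [FiniteDimensional K g] (ρ : g →ₗ⁅K⁆ Module.End K W) (hρ : Function.Injective ρ)
    (hn : ∀ x, IsNilpotent (ρ x)) : LieRing.IsNilpotent g := by
  rw [LieAlgebra.isNilpotent_iff_forall (R := K)]
  intro x
  obtain ⟨k, hk⟩ := LieAlgebra.ad_nilpotent_of_nilpotent (R := K) (hn x)
  have key : ∀ (k : ℕ) y, ρ ((LieAlgebra.ad K g x ^ k) y)
      = (LieAlgebra.ad K (Module.End K W) (ρ x) ^ k) (ρ y) := by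
    intro k
    induction k with
    | zero => simp
    | succ k ih =>
      intro y
      rw [pow_succ', pow_succ', Module.End.mul_apply, Module.End.mul_apply, ← ih,
        LieAlgebra.ad_apply, LieAlgebra.ad_apply, LieHom.map_lie]
  refine ⟨k, LinearMap.ext fun y => hρ ?_⟩
  rw [key, hk]
  simp

variable [CharZero K] [FiniteDimensional K W]

/-- The trace form of a Lie algebra of endomorphisms with trivial radical is nondegenerate. -/
theorem traceForm_nondegenerate (S : LieSubalgebra K (Module.End K W))
    [LieAlgebra.HasTrivialRadical K S] : (LieModule.traceForm K S W).Nondegenerate := by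
  refine (LieModule.traceForm_isSymm K S W).isRefl.nondegenerate_iff_separatingLeft.mpr ?_
  rw [LinearMap.separatingLeft_iff_ker_eq_bot]
  -- Invariance makes the kernel of the form an ideal. Its own trace form vanishes, so its derived
  -- ideal acts nilpotently and is nilpotent by Engel; hence `J` is solvable, and so zero.
  let J : LieIdeal K S :=
    { LinearMap.ker (LieModule.traceForm K S W) with
      lie_mem := fun {x y} hy => by
        change LieModule.traceForm K S W ⁅x, y⁆ = 0
        refine LinearMap.ext fun z => ?_
        rw [LieModule.traceForm_apply_lie_apply', LinearMap.mem_ker.1 hy]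
        simp }
  have htf : LieModule.traceForm K J W = 0 := by
    ext ⟨x, hx⟩ ⟨y, hy⟩
    exact LinearMap.congr_fun (LinearMap.mem_ker.1 hx) y
  have hnil := LieModule.isNilpotent_derivedSeries_of_traceForm_eq_zero htf
  rw [LieModule.isNilpotent_iff_forall' (R := K)] at hnil
  set DD := LieAlgebra.derivedSeries K J 1 with hDD
  have : LieRing.IsNilpotent DD := isNilpotent_of_injective_of_forall_isNilpotent
    (LieModule.toEnd K DD W) (fun x y h => by
      have h' : (x.1.1 : Module.End K W) = y.1.1 := LinearMap.ext fun w => LinearMap.congr_fun h w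
      exact Subtype.ext (Subtype.ext (Subtype.ext h'))) hnil
  have : LieAlgebra.IsSolvable (quotientHom DD).ker := by
    rw [ker_quotientHom]
    infer_instance
  have : IsLieAbelian (J ⧸ DD) := ⟨fun x y => by
    obtain ⟨x, rfl⟩ := quotientHom_surjective DD x
    obtain ⟨y, rfl⟩ := quotientHom_surjective DD y
    rw [← LieHom.map_lie, quotientHom_eq_zero]
    exact LieSubmodule.lie_mem_lie (LieSubmodule.mem_top x) (LieSubmodule.mem_top y)⟩
  have : LieAlgebra.IsSolvable J := isSolvable_of_isSolvable_ker (quotientHom DD)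
  have hJ : J = ⊥ := LieAlgebra.HasTrivialRadical.eq_bot_of_isSolvable J
  rw [Submodule.eq_bot_iff]
  intro x hx
  have : x ∈ J := hx
  rwa [hJ] at this

/-- The Casimir endomorphism of a nonzero Lie algebra of endomorphisms with trivial radical. -/
theorem exists_casimir (S : LieSubalgebra K (Module.End K W)) [LieAlgebra.HasTrivialRadical K S]
    (hS : ∃ x ∈ S, x ≠ 0) : ∃ C : Module.End K W, (∀ x ∈ S, Commute x C) ∧ ¬ IsNilpotent C ∧
      ∀ N : Submodule K W, (∀ x ∈ S, ∀ w, x w ∈ N) → ∀ w, C w ∈ N := by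
  classical
  have hB := traceForm_nondegenerate S
  set B := LieModule.traceForm K S W with hBdef
  have hsym : LinearMap.BilinForm.IsSymm B :=
    ⟨fun x y => LieModule.traceForm_comm K S W x y⟩
  let b := Module.finBasis K S
  let b' := LinearMap.BilinForm.dualBasis B hB b
  have hrepr' : ∀ y, ∑ j, B y (b j) • b' j = y := fun y => by
    conv_rhs => rw [← b'.sum_repr y]
    exact Finset.sum_congr rfl fun j _ => by rw [LinearMap.BilinForm.dualBasis_repr_apply]
  have hrepr : ∀ y, ∑ j, B (b' j) y • b j = y := by
    intro y
    conv_rhs => rw [← b.sum_repr y]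
    refine Finset.sum_congr rfl fun j _ => ?_
    congr 1
    refine LinearMap.congr_fun (f := B (b' j)) (g := b.coord j) (b.ext fun i => ?_) y
    rw [LinearMap.BilinForm.apply_dualBasis_left, b.coord_apply, b.repr_self_apply]
  -- For dual bases, invariance of the form makes the two sums in the expanded bracket cancel. Each
  -- product has trace `1`, so the trace is `dim S`, which is nonzero in characteristic zero and
  -- excludes nilpotency.
  refine ⟨∑ i, (b i : Module.End K W) * (b' i : Module.End K W), fun x hx => ?_, fun hnil => ?_,
    fun N hN w => ?_⟩
  · rw [commute_iff_lie_eq]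
    have h1 : ∀ i, ⁅x, (b i : Module.End K W) * (b' i : Module.End K W)⁆
        = ∑ j, B (b' j) ⁅(⟨x, hx⟩ : S), b i⁆ • ((b j : Module.End K W) * (b' i : Module.End K W))
        + ∑ j, B ⁅(⟨x, hx⟩ : S), b' i⁆ (b j) •
          ((b i : Module.End K W) * (b' j : Module.End K W)) := by
      intro i
      have e1 : ⁅x, (b i : Module.End K W)⁆
          = ∑ j, B (b' j) ⁅(⟨x, hx⟩ : S), b i⁆ • (b j : Module.End K W) := by
        have := congrArg (S.incl : S →ₗ[K] Module.End K W) (hrepr ⁅(⟨x, hx⟩ : S), b i⁆)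
        rw [map_sum] at this
        exact this.symm
      have e2 : ⁅x, (b' i : Module.End K W)⁆
          = ∑ j, B ⁅(⟨x, hx⟩ : S), b' i⁆ (b j) • (b' j : Module.End K W) := by
        have := congrArg (S.incl : S →ₗ[K] Module.End K W) (hrepr' ⁅(⟨x, hx⟩ : S), b' i⁆)
        rw [map_sum] at this
        exact this.symm
      have e3 : ⁅x, (b i : Module.End K W) * (b' i : Module.End K W)⁆
          = ⁅x, (b i : Module.End K W)⁆ * b' i + b i * ⁅x, (b' i : Module.End K W)⁆ := by
        simp only [Ring.lie_def]
        noncomm_ring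
      rw [e3, e1, e2, Finset.sum_mul, Finset.mul_sum]
      simp only [smul_mul_assoc, mul_smul_comm]
    rw [lie_sum, Finset.sum_congr rfl fun i _ => h1 i, Finset.sum_add_distrib,
      Finset.sum_comm (γ := Fin _), ← Finset.sum_add_distrib]
    refine Finset.sum_eq_zero fun i _ => ?_
    rw [← Finset.sum_add_distrib]
    refine Finset.sum_eq_zero fun j _ => ?_
    rw [← add_smul, hBdef, LieModule.traceForm_apply_lie_apply', add_neg_cancel, zero_smul]
  · have htr := (LinearMap.isNilpotent_trace_of_isNilpotent hnil).eq_zero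
    rw [map_sum] at htr
    have h1 : ∀ i, LinearMap.trace K W ((b i : Module.End K W) * (b' i : Module.End K W)) = 1 := by
      intro i
      have := LinearMap.BilinForm.apply_dualBasis_right hB hsym b i i
      rw [if_pos rfl] at this
      exact this
    rw [Finset.sum_congr rfl fun i _ => h1 i] at htr
    simp only [Finset.sum_const, Finset.card_univ, Fintype.card_fin, nsmul_eq_mul, mul_one,
      Nat.cast_eq_zero] at htr
    obtain ⟨x, hx, hx0⟩ := hS
    have := Module.finrank_zero_iff.1 htr
    exact hx0 (congrArg Subtype.val (Subsingleton.elim (⟨x, hx⟩ : S) 0))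
  · rw [LinearMap.sum_apply]
    exact Submodule.sum_mem _ fun i _ => hN _ (b i).2 _

end Casimir

/-! ### Endomorphisms scalar on a subspace -/

section Representations

variable {K : Type*} [Field K] {L : Type*} [LieRing L] [LieAlgebra K L]
  {X : Type*} [AddCommGroup X] [Module K X]

/-- The restriction of a representation to an invariant subspace. -/
def restrictHom (ρ : L →ₗ⁅K⁆ Module.End K X) (W : Submodule K X) (hW : ∀ x, ∀ w ∈ W, ρ x w ∈ W) :
    L →ₗ⁅K⁆ Module.End K W where
  toFun x := (ρ x).restrict (hW x)
  map_add' x y := LinearMap.ext fun w => Subtype.ext (by simp)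
  map_smul' c x := LinearMap.ext fun w => Subtype.ext (by simp)
  map_lie' {x y} := LinearMap.ext fun w => Subtype.ext (by simp [Ring.lie_def])

/-- The endomorphisms with values in `U` that are scalar on `U`. -/
def scalarOn (U : Submodule K X) : Submodule K (Module.End K X) where
  carrier := {m | (∀ v, m v ∈ U) ∧ ∃ c : K, ∀ u ∈ U, m u = c • u}
  add_mem' := by
    rintro a b ⟨ha, c, hc⟩ ⟨hb, d, hd⟩
    exact ⟨fun v => add_mem (ha v) (hb v), c + d, fun u hu => by
      rw [LinearMap.add_apply, hc u hu, hd u hu, add_smul]⟩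
  zero_mem' := ⟨fun _ => zero_mem _, 0, fun u _ => by simp⟩
  smul_mem' := by
    rintro r a ⟨ha, c, hc⟩
    exact ⟨fun v => U.smul_mem r (ha v), r * c, fun u hu => by
      rw [LinearMap.smul_apply, hc u hu, mul_smul]⟩

/-- The endomorphisms that vanish on `U`. -/
def zeroOn (U : Submodule K X) : Submodule K (Module.End K X) where
  carrier := {m | ∀ u ∈ U, m u = 0}
  add_mem' ha hb u hu := by rw [LinearMap.add_apply, ha u hu, hb u hu, add_zero]
  zero_mem' u _ := rfl
  smul_mem' r a ha u hu := by rw [LinearMap.smul_apply, ha u hu, smul_zero]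

/-- On `U` the map `m` is a scalar, which commutes with `A`. This is the hypothesis "`W` is sent
into `N`" of the splitting principle. -/
theorem lie_mem_scalarOn {U : Submodule K X} {A : Module.End K X} (hA : ∀ u ∈ U, A u ∈ U)
    {m : Module.End K X} (hm : m ∈ scalarOn U) : ⁅A, m⁆ ∈ scalarOn U ⊓ zeroOn U := by
  obtain ⟨h1, c, hc⟩ := hm
  have h0 : ∀ u ∈ U, ⁅A, m⁆ u = 0 := fun u hu => by
    rw [Ring.lie_def, LinearMap.sub_apply, Module.End.mul_apply, Module.End.mul_apply, hc u hu,
      hc _ (hA u hu), map_smul, sub_self]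
  exact ⟨⟨fun v => sub_mem (hA _ (h1 v)) (h1 _), 0, fun u hu => by rw [h0 u hu, zero_smul]⟩, h0⟩

theorem exists_mem_scalarOn (U : Submodule K X) : ∃ m ∈ scalarOn U, ∀ u ∈ U, m u = u := by
  obtain ⟨p, hp⟩ := U.subtype.exists_leftInverse_of_injective U.ker_subtype
  have h : ∀ u ∈ U, (U.subtype ∘ₗ p) u = u := fun u hu =>
    congrArg Subtype.val (LinearMap.congr_fun hp ⟨u, hu⟩)
  exact ⟨U.subtype ∘ₗ p, ⟨fun v => (p v).2, 1, fun u hu => by rw [h u hu, one_smul]⟩, h⟩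

end Representations

/-! ### Whitehead's lemma and Weyl's theorem -/

section Weyl

variable {K : Type*} [Field K] [CharZero K] {L S : Type*} [LieRing L] [LieAlgebra K L] [LieRing S]
  [LieAlgebra K S] [FiniteDimensional K S] [LieAlgebra.HasTrivialRadical K S]
  {X : Type*} [AddCommGroup X] [Module K X] [FiniteDimensional K X]

/-- Vanishing of the first cohomology of a semisimple Lie algebra: if a representation maps an
invariant subspace `W`, on which it factors through a semisimple Lie algebra, to `N`, then `W` is
the sum of `W ∩ N` and of the invariant vectors of `W`. -/
theorem exists_mem_inf_forall_apply_sub_eq_zero (f : L →ₗ⁅K⁆ S) (hf : Function.Surjective f)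
    (ρ : L →ₗ⁅K⁆ Module.End K X) (N W : Submodule K X) (hW : ∀ x, ∀ w ∈ W, ρ x w ∈ W)
    (hN : ∀ x, ∀ w ∈ W, ρ x w ∈ N) (hker : ∀ x, f x = 0 → ∀ w ∈ W, ρ x w = 0) {w : X}
    (hw : w ∈ W) : ∃ n ∈ W ⊓ N, ∀ x, ρ x (w - n) = 0 := by
  induction hd : Module.finrank K W using Nat.strong_induction_on generalizing W w with
  | _ d ih =>
  subst hd
  by_cases h : ∀ x, ∀ w ∈ W, ρ x w = 0
  · exact ⟨0, zero_mem _, fun x => by simpa using h x w hw⟩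
  push Not at h
  obtain ⟨x₀, w₀, hw₀, hx₀⟩ := h
  set σ := restrictHom ρ W hW with hσ
  have : LieAlgebra.HasTrivialRadical K σ.range :=
    hasTrivialRadical_of_surjective_of_ker_le f hf σ.rangeRestrict σ.surjective_rangeRestrict
      fun x hx => Subtype.ext (LinearMap.ext fun w => Subtype.ext (hker x hx w w.2))
  obtain ⟨C, hC, hnil, hCN⟩ := exists_casimir σ.range ⟨σ x₀, σ.mem_range_self x₀, fun h =>
    hx₀ (congrArg Subtype.val (LinearMap.congr_fun h ⟨w₀, hw₀⟩))⟩
  replace hC : ∀ x, Commute (σ x) C := fun x => hC _ (σ.mem_range_self x)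
  have hCN' : ∀ w, C w ∈ N.comap W.subtype := hCN _ (by
    rintro _ ⟨x, rfl⟩ w
    exact hN x w w.2)
  -- Fitting decomposition for the Casimir `C`. Since `k ≥ 1`, the range of `C ^ k` lies in `N` and
  -- needs no further correction; the kernel is invariant, and proper because `C` is not nilpotent,
  -- so induction applies to it.
  obtain ⟨k, hk, hk1⟩ := (C.eventually_isCompl_ker_pow_range_pow.and
    (Filter.eventually_ge_atTop 1)).exists
  set W' := (LinearMap.ker (C ^ k)).map W.subtype with hW'
  have hlt : W' < W := by
    refine lt_of_le_of_ne (Submodule.map_subtype_le _ _) fun h => hnil ⟨k, ?_⟩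
    refine LinearMap.ext fun w => ?_
    obtain ⟨u, hu, huw⟩ := h.ge w.2
    have : u = w := Subtype.ext huw
    exact this ▸ hu
  have hW's : ∀ x, ∀ w ∈ W', ρ x w ∈ W' := by
    rintro x _ ⟨u, hu, rfl⟩
    refine ⟨σ x u, ?_, rfl⟩
    have := LinearMap.congr_fun ((hC x).pow_right k).eq u
    simp only [Module.End.mul_apply, LinearMap.mem_ker.1 hu, map_zero] at this
    exact this.symm
  obtain ⟨y, hy, z, hz, hyz⟩ := Submodule.mem_sup.1
    (hk.sup_eq_top ▸ Submodule.mem_top : (⟨w, hw⟩ : W) ∈ _)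
  have hzN : (z : X) ∈ N := by
    obtain ⟨v, rfl⟩ := hz
    obtain ⟨l, rfl⟩ := Nat.exists_eq_add_of_le' hk1
    rw [pow_succ']
    exact hCN' _
  obtain ⟨n, hn, hn'⟩ := ih _ (Submodule.finrank_lt_finrank_of_lt hlt) W' hW's
    (fun x w hw => hN x w (hlt.le hw)) (fun x hx w hw => hker x hx w (hlt.le hw))
    (w := y) ⟨y, hy, rfl⟩ rfl
  refine ⟨n + z, ⟨add_mem (hlt.le hn.1) z.2, add_mem hn.2 hzN⟩, fun x => ?_⟩
  have hwe : w = y + z := (congrArg Subtype.val hyz).symm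
  rw [hwe, add_sub_add_right_eq_sub]
  exact hn' x

/-- Weyl's theorem: an invariant subspace has an equivariant projection. -/
theorem exists_mem_scalarOn_forall_commute (f : L →ₗ⁅K⁆ S) (hf : Function.Surjective f)
    (ρ : L →ₗ⁅K⁆ Module.End K X) (hker : ∀ x, f x = 0 → ρ x = 0) (U : Submodule K X)
    (hU : ∀ x, ∀ u ∈ U, ρ x u ∈ U) :
    ∃ m ∈ scalarOn U, (∀ u ∈ U, m u = u) ∧ ∀ x, ⁅ρ x, m⁆ = 0 := by
  obtain ⟨m₀, hm₀, h₀⟩ := exists_mem_scalarOn U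
  obtain ⟨n, hn, hx⟩ := exists_mem_inf_forall_apply_sub_eq_zero f hf
    ((LieAlgebra.ad K (Module.End K X)).comp ρ) (zeroOn U) (scalarOn U)
    (fun x w hw => (lie_mem_scalarOn (hU x) hw).1) (fun x w hw => (lie_mem_scalarOn (hU x) hw).2)
    (fun x hx w _ => by simp [hker x hx]) hm₀
  exact ⟨m₀ - n, sub_mem hm₀ hn.1, fun u hu => by
    rw [LinearMap.sub_apply, h₀ u hu, hn.2 u hu, sub_zero], hx⟩

end Weyl

/-! ### Equivariant Levi splitting -/

section Levi

variable {K : Type*} [Field K]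

/-- The image of an invariant complement to `p.comap g` is an invariant complement to `p`. -/
theorem isSemisimple_of_surjective {X Y : Type*} [AddCommGroup X] [Module K X] [AddCommGroup Y]
    [Module K Y] {A : Module.End K X} {B : Module.End K Y} (hA : A.IsSemisimple) (g : X →ₗ[K] Y)
    (hg : Function.Surjective g) (h : ∀ x, g (A x) = B (g x)) : B.IsSemisimple := by
  rw [Module.End.isSemisimple_iff] at hA ⊢
  intro p hp
  obtain ⟨q, hq, hc⟩ := hA (p.comap g) fun x hx => by
    change g (A x) ∈ p
    rw [h]
    exact hp hx
  refine ⟨q.map g, ?_, ?_, ?_⟩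
  · rintro _ ⟨x, hx, rfl⟩
    exact ⟨A x, hq hx, h x⟩
  · rw [Submodule.disjoint_def]
    rintro _ hxp ⟨x, hx, rfl⟩
    rw [Submodule.disjoint_def.1 hc.disjoint x hxp hx, map_zero]
  · rw [codisjoint_iff, eq_top_iff]
    intro y _
    obtain ⟨x, rfl⟩ := hg y
    obtain ⟨a, ha, b, hb, rfl⟩ := Submodule.mem_sup.1
      (hc.sup_eq_top ▸ Submodule.mem_top : x ∈ p.comap g ⊔ q)
    rw [map_add]
    exact Submodule.add_mem_sup ha ⟨b, hb, rfl⟩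

variable {L S : Type*} [LieRing L] [LieAlgebra K L] [LieRing S] [LieAlgebra K S]

theorem derivation_mem_lie {D : Module.End K L} (hD : ∀ x y, D ⁅x, y⁆ = ⁅D x, y⁆ + ⁅x, D y⁆)
    {I : LieIdeal K L} (hI : ∀ x ∈ I, D x ∈ I) : ∀ x ∈ ⁅I, I⁆, D x ∈ ⁅I, I⁆ := by
  intro x hx
  rw [← LieSubmodule.mem_toSubmodule, LieSubmodule.lieIdeal_oper_eq_linear_span'] at hx
  induction hx using Submodule.span_induction with
  | mem u hu =>
    obtain ⟨a, ha, b, hb, rfl⟩ := hu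
    rw [hD]
    exact add_mem (LieSubmodule.lie_mem_lie (hI a ha) hb) (LieSubmodule.lie_mem_lie ha (hI b hb))
  | zero => simp
  | add u v _ _ hu hv => rw [map_add]; exact add_mem hu hv
  | smul t u _ hu => rw [map_smul]; exact Submodule.smul_mem _ t hu

variable [CharZero K] [FiniteDimensional K L] [FiniteDimensional K S]
  [LieAlgebra.HasTrivialRadical K S]

/-- A central extension of a semisimple Lie algebra is split by its derived algebra. -/
theorem bijective_on_lie_top_top_of_ker_le_center (f : L →ₗ⁅K⁆ S) (hf : Function.Surjective f)
    (hker : ∀ x, f x = 0 → ∀ y : L, ⁅x, y⁆ = 0) :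
    (∀ x ∈ ⁅(⊤ : LieIdeal K L), (⊤ : LieIdeal K L)⁆, f x = 0 → x = 0) ∧
      ∀ t, ∃ x ∈ ⁅(⊤ : LieIdeal K L), (⊤ : LieIdeal K L)⁆, f x = t := by
  constructor
  · obtain ⟨m, hm, hid, hx⟩ := exists_mem_scalarOn_forall_commute f hf (LieAlgebra.ad K L)
      (fun x hx => LinearMap.ext fun y => hker x hx y) (LinearMap.ker (f : L →ₗ[K] S))
      (fun x u hu => by
        change f ⁅x, u⁆ = 0
        have : f u = 0 := hu
        rw [LieHom.map_lie, this, lie_zero])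
    have h0 : ∀ x ∈ ⁅(⊤ : LieIdeal K L), (⊤ : LieIdeal K L)⁆, m x = 0 := by
      intro x h
      rw [← LieSubmodule.mem_toSubmodule, LieSubmodule.lieIdeal_oper_eq_linear_span'] at h
      induction h using Submodule.span_induction with
      | mem u hu =>
        obtain ⟨a, -, b, -, rfl⟩ := hu
        have h1 := LinearMap.congr_fun (hx a) b
        rw [Ring.lie_def, LinearMap.sub_apply, Module.End.mul_apply, Module.End.mul_apply,
          LieAlgebra.ad_apply, LieAlgebra.ad_apply, ← lie_skew, hker _ (hm.1 b) a] at h1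
        simpa using h1
      | zero => simp
      | add u v _ _ hu hv => rw [map_add, hu, hv, add_zero]
      | smul t u _ hu => rw [map_smul, hu, smul_zero]
    intro x hx h
    rw [← hid x h, h0 x hx]
  · intro t
    have ht : t ∈ ⁅(⊤ : LieIdeal K S), (⊤ : LieIdeal K S)⁆ :=
      (lie_top_top_of_hasTrivialRadical (K := K) (S := S)).ge (LieSubmodule.mem_top t)
    rw [← LieSubmodule.mem_toSubmodule, LieSubmodule.lieIdeal_oper_eq_linear_span'] at ht
    induction ht using Submodule.span_induction with
    | mem u hu =>
      obtain ⟨a, -, b, -, rfl⟩ := hu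
      obtain ⟨a, rfl⟩ := hf a
      obtain ⟨b, rfl⟩ := hf b
      exact ⟨⁅a, b⁆, LieSubmodule.lie_mem_lie (LieSubmodule.mem_top a) (LieSubmodule.mem_top b),
        f.map_lie a b⟩
    | zero => exact ⟨0, zero_mem _, map_zero f⟩
    | add u v _ _ hu hv =>
      obtain ⟨a, ha, rfl⟩ := hu
      obtain ⟨b, hb, rfl⟩ := hv
      exact ⟨a + b, add_mem ha hb, map_add f a b⟩
    | smul t u _ hu =>
      obtain ⟨a, ha, rfl⟩ := hu
      exact ⟨t • a, Submodule.smul_mem _ t ha, map_smul f t a⟩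

/-- For an abelian extension of a semisimple Lie algebra by an ideal `I`, there is a projection
`m` onto `I` that commutes with a given semisimple derivation and that is equivariant up to inner
derivations by `I`. -/
theorem exists_projection_of_ker_abelian (f : L →ₗ⁅K⁆ S) (hf : Function.Surjective f)
    (hab : ∀ x y, f x = 0 → f y = 0 → ⁅x, y⁆ = 0) {D : Module.End K L} (hss : D.IsSemisimple)
    (hD : ∀ x y, D ⁅x, y⁆ = ⁅D x, y⁆ + ⁅x, D y⁆) (hDf : ∀ x, f x = 0 → f (D x) = 0) :
    ∃ m : Module.End K L, (∀ x, f (m x) = 0) ∧ (∀ x, f x = 0 → m x = x) ∧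
      (∀ x : L, ∃ y : L, f y = 0 ∧ ∀ z : L, ⁅x, m z⁆ - m ⁅x, z⁆ = ⁅y, z⁆) ∧ ∀ x, D (m x) = m (D x) := by
  set I : Submodule K L := LinearMap.ker (f : L →ₗ[K] S) with hI
  have hIm : ∀ {x}, x ∈ I ↔ f x = 0 := Iff.rfl
  have hIl : ∀ x, ∀ u ∈ I, LieAlgebra.ad K L x u ∈ I := fun x u hu => by
    rw [hIm] at hu ⊢
    rw [LieAlgebra.ad_apply, LieHom.map_lie, hu, lie_zero]
  -- The kernel `I` need not act trivially on `scalarOn I`, but it does modulo `P = ad I`, where the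
  -- action factors through `S` and the splitting principle applies.
  let P : LieSubmodule K L (L →ₗ[K] L) :=
    { I.map (LieAlgebra.ad K L : L →ₗ[K] Module.End K L) with
      lie_mem := by
        rintro x _ ⟨u, hu, rfl⟩
        refine ⟨⁅x, u⁆, hIl x u hu, ?_⟩
        change LieAlgebra.ad K L ⁅x, u⁆ = _
        rw [LieHom.map_lie]
        rfl }
  have hPm : ∀ A : Module.End K L, A ∈ P ↔ ∃ u ∈ I, LieAlgebra.ad K L u = A := fun A => Iff.rfl
  let q : (L →ₗ[K] L) →ₗ[K] (L →ₗ[K] L) ⧸ P := LieSubmodule.Quotient.mk' P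
  have hq0 : ∀ A : Module.End K L, q A = 0 ↔ A ∈ P := fun A => LieSubmodule.Quotient.mk_eq_zero P
  have hq : ∀ (x : L) (A : Module.End K L), LieModule.toEnd K L ((L →ₗ[K] L) ⧸ P) x (q A)
      = q ⁅LieAlgebra.ad K L x, A⁆ := fun x A => rfl
  obtain ⟨m₀, hm₀, hid₀⟩ := exists_mem_scalarOn I
  obtain ⟨n, hn, hnx⟩ := exists_mem_inf_forall_apply_sub_eq_zero f hf
    (LieModule.toEnd K L ((L →ₗ[K] L) ⧸ P)) ((scalarOn I ⊓ zeroOn I).map q) ((scalarOn I).map q)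
    (by
      rintro x _ ⟨A, hA, rfl⟩
      exact ⟨_, (lie_mem_scalarOn (hIl x) hA).1, rfl⟩)
    (by
      rintro x _ ⟨A, hA, rfl⟩
      exact ⟨_, lie_mem_scalarOn (hIl x) hA, rfl⟩)
    (by
      rintro x hx _ ⟨A, ⟨hA, c, hc⟩, rfl⟩
      rw [hq, hq0, hPm]
      -- Here `⁅ad x, A⁆ = -c ad x`: the term `⁅x, A y⁆` vanishes as `I` is abelian, and `A` is the
      -- scalar `c` on `⁅x, y⁆ ∈ I`.
      refine ⟨-(c • x), neg_mem (I.smul_mem c hx), LinearMap.ext fun y => ?_⟩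
      rw [Ring.lie_def, LinearMap.sub_apply, Module.End.mul_apply, Module.End.mul_apply,
        LieAlgebra.ad_apply, LieAlgebra.ad_apply, LieAlgebra.ad_apply, hab _ _ hx (hA y),
        hc ⁅x, y⁆ (by rw [hIm, LieHom.map_lie, hx, zero_lie])]
      simp)
    (Submodule.mem_map_of_mem hm₀)
  obtain ⟨-, n, ⟨hn, hn0⟩, rfl⟩ := hn
  have hm₁ : ∀ x, ⁅LieAlgebra.ad K L x, m₀ - n⁆ ∈ P := fun x => by
    rw [← hq0, ← hq, map_sub]
    exact hnx x
  -- The candidates equivariant modulo `ad I` form an `ad D`-stable space, because `⁅D, ad x⁆ = ad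
  -- (D x)`. The semisimple splitting principle inside `Q` makes the projection commute with `D` as
  -- well.
  let Q : Submodule K (Module.End K L) := scalarOn I ⊓
    ⨅ x, P.toSubmodule.comap (LieAlgebra.ad K (Module.End K L) (LieAlgebra.ad K L x))
  have hQ : ∀ A, A ∈ Q ↔ A ∈ scalarOn I ∧ ∀ x, ⁅LieAlgebra.ad K L x, A⁆ ∈ P := fun A => by
    simp only [Q, Submodule.mem_inf, Submodule.mem_iInf, Submodule.mem_comap]
    rfl
  have had : ∀ x, ⁅D, LieAlgebra.ad K L x⁆ = LieAlgebra.ad K L (D x) := fun x =>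
    LinearMap.ext fun y => by
      rw [Ring.lie_def, LinearMap.sub_apply, Module.End.mul_apply, Module.End.mul_apply,
        LieAlgebra.ad_apply, LieAlgebra.ad_apply, LieAlgebra.ad_apply, hD, add_sub_cancel_right]
  obtain ⟨n', hn', hDn'⟩ := exists_mem_inf_forall_apply_sub_eq_zero_of_isSemisimple
    {LieAlgebra.ad K (Module.End K L) D}
    (by rintro _ rfl _ rfl; exact Commute.refl _)
    (by rintro _ rfl; exact LieAlgebra.ad_isSemisimple_of_isSemisimple hss) (zeroOn I) Q
    (by
      rintro _ rfl A hA
      rw [hQ] at hA ⊢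
      refine ⟨(lie_mem_scalarOn hDf hA.1).1, fun x => ?_⟩
      obtain ⟨u, hu, hux⟩ := hA.2 x
      have hux' : LieAlgebra.ad K L u = ⁅LieAlgebra.ad K L x, A⁆ := hux
      rw [LieAlgebra.ad_apply, leibniz_lie, ← lie_skew (LieAlgebra.ad K L x) D, had, ← hux', had, neg_lie]
      exact add_mem (neg_mem (hA.2 _)) ⟨D u, hDf u hu, rfl⟩)
    (by
      rintro _ rfl A hA
      exact (lie_mem_scalarOn hDf ((hQ A).1 hA).1).2)
    (w := m₀ - n) ((hQ _).2 ⟨sub_mem hm₀ hn, hm₁⟩)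
  have hm := (hQ _).1 (sub_mem ((hQ (m₀ - n)).2 ⟨sub_mem hm₀ hn, hm₁⟩) hn'.1)
  refine ⟨m₀ - n - n', fun x => hm.1.1 x, fun x hx => ?_, fun x => ?_, fun x => ?_⟩
  · rw [LinearMap.sub_apply, LinearMap.sub_apply, hid₀ x hx, hn0 x hx, hn'.2 x hx, sub_zero,
      sub_zero]
  · obtain ⟨y, hy, hyx⟩ := (hPm _).1 (hm.2 x)
    exact ⟨y, hy, fun z => (LinearMap.congr_fun hyx z).symm⟩
  · exact sub_eq_zero.1 (LinearMap.congr_fun (hDn' _ rfl) x)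

/-- Let `s` consist of the `x` whose `ad x` commutes with the projection `m`. Any `x` can be moved
into `s` by adding an element of the kernel, so `s` still maps onto `S`; and the kernel inside `s`
is central. The derived algebra of `s` is then the required section, and it is `D`-stable because
`D` commutes with `m`. -/
theorem exists_section_of_ker_abelian (f : L →ₗ⁅K⁆ S) (hf : Function.Surjective f)
    (hab : ∀ x y, f x = 0 → f y = 0 → ⁅x, y⁆ = 0) {D : Module.End K L} (hss : D.IsSemisimple)
    (hD : ∀ x y, D ⁅x, y⁆ = ⁅D x, y⁆ + ⁅x, D y⁆) (hDf : ∀ x, f x = 0 → f (D x) = 0) :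
    ∃ s : LieSubalgebra K L, (∀ x ∈ s, D x ∈ s) ∧ (∀ x ∈ s, f x = 0 → x = 0) ∧
      ∀ t, ∃ x ∈ s, f x = t := by
  obtain ⟨m, hmf, hid, hmP, hmD⟩ := exists_projection_of_ker_abelian f hf hab hss hD hDf
  let s : LieSubalgebra K L :=
    { carrier := {x | ∀ z : L, ⁅x, m z⁆ = m ⁅x, z⁆}
      add_mem' := fun {a b} ha hb z => by rw [add_lie, add_lie, ha z, hb z, map_add]
      zero_mem' := fun z => by simp
      smul_mem' := fun c a ha z => by rw [smul_lie, smul_lie, ha z, map_smul]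
      lie_mem' := fun {a b} ha hb z => by
        have ha : ∀ z : L, ⁅a, m z⁆ = m ⁅a, z⁆ := ha
        have hb : ∀ z : L, ⁅b, m z⁆ = m ⁅b, z⁆ := hb
        rw [lie_lie, hb, ha, ha, hb, lie_lie, map_sub] }
  have hs : ∀ x, x ∈ s ↔ ∀ z : L, ⁅x, m z⁆ = m ⁅x, z⁆ := fun x => Iff.rfl
  have hsD : ∀ x ∈ s, D x ∈ s := fun x hx z => by
    have e1 := hD x (m z)
    have e2 := hD x z
    rw [hx z, hmD, hmD, hx (D z), e2, map_add] at e1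
    exact (add_right_cancel e1).symm
  obtain ⟨h1, h2⟩ := bijective_on_lie_top_top_of_ker_le_center (f.comp s.incl)
    (fun t => by
      obtain ⟨x, rfl⟩ := hf t
      obtain ⟨y, hy, hyx⟩ := hmP x
      refine ⟨⟨x + y, fun z => ?_⟩, ?_⟩
      · have e := hyx z
        have e1 : ⁅y, m z⁆ = 0 := hab _ _ hy (hmf z)
        have e2 : m ⁅y, z⁆ = ⁅y, z⁆ := hid _ (by rw [LieHom.map_lie, hy, zero_lie])
        rw [add_lie, add_lie, map_add, e1, e2, ← e]
        abel
      · change f (x + y) = f x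
        rw [map_add, hy, add_zero])
    (fun x hx y => Subtype.ext (by
      have hx : f x = 0 := hx
      have e := (hs x).1 x.2 y
      rw [hab _ _ hx (hmf y), hid _ (by rw [LieHom.map_lie, hx, zero_lie])] at e
      exact e.symm))
  refine ⟨(⁅(⊤ : LieIdeal K s), (⊤ : LieIdeal K s)⁆.toLieSubalgebra).map s.incl, ?_, ?_, ?_⟩
  · rintro _ ⟨x, hx, rfl⟩
    refine ⟨D.restrict hsD x, ?_, rfl⟩
    exact derivation_mem_lie (D := D.restrict hsD) (fun x y => Subtype.ext (hD x y))
      (I := ⊤) (fun _ _ => LieSubmodule.mem_top _) x hx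
  · rintro _ ⟨x, hx, rfl⟩ h
    exact congrArg Subtype.val (h1 x hx h)
  · intro t
    obtain ⟨x, hx, rfl⟩ := h2 t
    exact ⟨x, ⟨x, hx, rfl⟩, rfl⟩

/-- The Levi-Malcev theorem, equivariant with respect to a semisimple derivation: an extension of a
semisimple Lie algebra with solvable kernel has a section stable under the derivation. -/
theorem exists_section_of_ker_isSolvable {L : Type*} [LieRing L] [LieAlgebra K L]
    [FiniteDimensional K L] (f : L →ₗ⁅K⁆ S) (hf : Function.Surjective f)
    [LieAlgebra.IsSolvable f.ker] {D : Module.End K L} (hss : D.IsSemisimple)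
    (hD : ∀ x y, D ⁅x, y⁆ = ⁅D x, y⁆ + ⁅x, D y⁆) (hDf : ∀ x, f x = 0 → f (D x) = 0) :
    ∃ s : LieSubalgebra K L, (∀ x ∈ s, D x ∈ s) ∧ (∀ x ∈ s, f x = 0 → x = 0) ∧
      ∀ t, ∃ x ∈ s, f x = t := by
  induction hd : Module.finrank K f.ker using Nat.strong_induction_on generalizing L with
  | _ d ih =>
  subst hd
  set J : LieIdeal K L := ⁅f.ker, f.ker⁆ with hJ
  have hJf : ∀ x ∈ J, f x = 0 := fun x hx => LieSubmodule.lie_le_left f.ker f.ker hx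
  by_cases hJ0 : J = ⊥
  · refine exists_section_of_ker_abelian f hf (fun x y hx hy => ?_) hss hD hDf
    have : ⁅x, y⁆ ∈ J := LieSubmodule.lie_mem_lie (I := f.ker) (N := f.ker) hx hy
    rwa [hJ0] at this
  have hlt : J < f.ker := by
    refine lt_of_le_of_ne (LieSubmodule.lie_le_left _ _) fun h => hJ0 ?_
    have hne : ∀ k, LieAlgebra.derivedSeriesOfIdeal K L k f.ker = f.ker := by
      intro k
      induction k with
      | zero => rfl
      | succ k ih => rw [LieAlgebra.derivedSeriesOfIdeal_succ, ih]; exact h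
    obtain ⟨k, hk⟩ := LieAlgebra.IsSolvable.solvable K f.ker
    rw [LieIdeal.derivedSeries_eq_bot_iff, hne] at hk
    rw [h, hk]
  obtain ⟨g, hg⟩ := exists_comp_eq_of_ker_le (quotientHom J) (quotientHom_surjective J) f
    fun x hx => hJf x ((quotientHom_eq_zero J x).1 hx)
  have hDJ : ∀ x ∈ J, D x ∈ J := derivation_mem_lie hD hDf
  let D' : Module.End K (L ⧸ J) := J.toSubmodule.mapQ J.toSubmodule D hDJ
  have hD' : ∀ x, quotientHom J (D x) = D' (quotientHom J x) := fun x => rfl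
  obtain ⟨s', hs'D, hs'f, hs't⟩ := exists_section_of_ker_abelian (D := D') g
    (fun t => by
      obtain ⟨x, rfl⟩ := hf t
      exact ⟨_, hg x⟩)
    (fun x y hx hy => by
      obtain ⟨x, rfl⟩ := quotientHom_surjective J x
      obtain ⟨y, rfl⟩ := quotientHom_surjective J y
      rw [hg] at hx hy
      rw [← LieHom.map_lie, quotientHom_eq_zero]
      exact LieSubmodule.lie_mem_lie (I := f.ker) (N := f.ker) hx hy)
    (isSemisimple_of_surjective hss (quotientHom J : L →ₗ[K] L ⧸ J) (quotientHom_surjective J) hD')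
    (fun x y => by
      obtain ⟨x, rfl⟩ := quotientHom_surjective J x
      obtain ⟨y, rfl⟩ := quotientHom_surjective J y
      simp only [← LieHom.map_lie, ← hD', hD, map_add])
    (fun x hx => by
      obtain ⟨x, rfl⟩ := quotientHom_surjective J x
      rw [hg] at hx
      rw [← hD', hg]
      exact hDf x hx)
  -- The preimage of the section of `L ⧸ J` still maps onto `S`, with kernel inside `J`, hence of
  -- smaller dimension than `f.ker`.
  let H : LieSubalgebra K L := s'.comap (quotientHom J)
  have hH : ∀ x, x ∈ H ↔ quotientHom J x ∈ s' := fun x => Iff.rfl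
  have hHD : ∀ x ∈ H, D x ∈ H := fun x hx => hs'D _ hx
  let F := f.comp H.incl
  have hF : ∀ x, F x = f x := fun x => rfl
  have hFJ : ∀ x : H, F x = 0 → (x : L) ∈ J := fun x hx => by
    rw [← quotientHom_eq_zero]
    exact hs'f _ x.2 (by rw [hg]; exact hx)
  have : LieAlgebra.IsSolvable F.ker := by
    let i : F.ker →ₗ⁅K⁆ f.ker :=
      { toFun := fun x => ⟨x.1.1, x.2⟩
        map_add' := fun x y => rfl
        map_smul' := fun c x => rfl
        map_lie' := fun {x y} => rfl }
    refine Function.Injective.lieAlgebra_isSolvable (f := i) fun x y h => ?_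
    exact Subtype.ext (Subtype.ext (congrArg (fun z : f.ker => (z : L)) h))
  have hfin : Module.finrank K F.ker < Module.finrank K f.ker := by
    refine lt_of_le_of_lt ?_ (Submodule.finrank_lt_finrank_of_lt (s := J.toSubmodule)
      (t := f.ker.toSubmodule) hlt)
    refine LinearMap.finrank_le_finrank_of_injective (f :=
      { toFun := fun x : F.ker => (⟨x.1.1, hFJ x.1 x.2⟩ : J.toSubmodule)
        map_add' := fun x y => rfl
        map_smul' := fun c x => rfl }) fun x y h => ?_
    exact Subtype.ext (Subtype.ext (congrArg (fun z : J.toSubmodule => (z : L)) h))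
  obtain ⟨s, hsD, hsf, hst⟩ := ih _ hfin F
    (fun t => by
      obtain ⟨x, hx, hxt⟩ := hs't t
      obtain ⟨x, rfl⟩ := quotientHom_surjective J x
      exact ⟨⟨x, hx⟩, by rw [hF, ← hg, hxt]⟩)
    (hss.restrict (p := H.toSubmodule) hHD) (fun x y => Subtype.ext (hD x y))
    (fun x hx => hDf x hx) rfl
  refine ⟨s.map H.incl, ?_, ?_, ?_⟩
  · rintro _ ⟨x, hx, rfl⟩
    exact ⟨_, hsD x hx, rfl⟩
  · rintro _ ⟨x, hx, rfl⟩ h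
    exact congrArg Subtype.val (hsf x hx h)
  · intro t
    obtain ⟨x, hx, rfl⟩ := hst t
    exact ⟨x, ⟨x, hx, rfl⟩, rfl⟩

end Levi

/-! ### Gradings as diagonal operators -/

section Scale

variable {K : Type*} [Field K] {M : Type*} [AddCommGroup M] [Module K M]

open DirectSum

/-- The endomorphism that acts on the summand of degree `p` as the scalar `c p`. -/
noncomputable def scale (ℳ : ℤ → Submodule K M) [Decomposition ℳ] (c : ℤ → K) :
    Module.End K M :=
  DirectSum.toModule K ℤ M (fun p => c p • (ℳ p).subtype) ∘ₗ
    (decomposeLinearEquiv ℳ : M →ₗ[K] ⨁ i, ℳ i)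

theorem scale_apply_of_mem (ℳ : ℤ → Submodule K M) [Decomposition ℳ] (c : ℤ → K) {p : ℤ} {m : M}
    (hm : m ∈ ℳ p) : scale ℳ c m = c p • m := by
  lift m to ℳ p using hm
  change DirectSum.toModule K ℤ M (fun p => c p • (ℳ p).subtype) (decompose ℳ (m : M)) = _
  rw [decompose_coe, ← lof_eq_of K, toModule_lof]
  rfl

theorem ext_of_forall_mem (ℳ : ℤ → Submodule K M) [Decomposition ℳ] {A B : Module.End K M}
    (h : ∀ p, ∀ m ∈ ℳ p, A m = B m) : A = B := by
  refine LinearMap.ext fun m => ?_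
  induction m using Decomposition.inductionOn ℳ with
  | zero => simp
  | homogeneous m => exact h _ m m.2
  | add m m' h h' => rw [map_add, map_add, h, h']

/-- Lagrange interpolation at the distinct eigenvalues `c p` gives a polynomial in `A` that extracts
the component of degree `i` from a given vector. -/
theorem isHomogeneous_of_forall_apply_mem (ℳ : ℤ → Submodule K M) [Decomposition ℳ] {c : ℤ → K}
    (hc : Function.Injective c) {A : Module.End K M} (hA : ∀ p, ∀ m ∈ ℳ p, A m = c p • m)
    {U : Submodule K M} (hU : ∀ u ∈ U, A u ∈ U) : U.IsHomogeneous ℳ := by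
  classical
  intro i x hx
  -- The degree `i` may lie outside the support of `x`, yet the basis polynomial needs it as a node.
  set s := insert i (decompose ℳ x).support with hs
  set P := Lagrange.basis s c i with hP
  have key : Polynomial.aeval A P x = decompose ℳ x i := by
    conv_lhs => rw [← sum_support_decompose ℳ x, map_sum]
    have h1 : ∀ j ∈ (decompose ℳ x).support, Polynomial.aeval A P (decompose ℳ x j : M)
        = if j = i then (decompose ℳ x i : M) else 0 := by
      intro j hj
      rw [Module.End.aeval_apply_of_mem_apply_eq_smul (hA j _ (decompose ℳ x j).2)]
      split_ifs with h
      · subst h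
        rw [Lagrange.eval_basis_self hc.injOn (Finset.mem_insert_self _ _), one_smul]
      · rw [Lagrange.eval_basis_of_ne (Ne.symm h) (Finset.mem_insert_of_mem hj), zero_smul]
    rw [Finset.sum_congr rfl h1, Finset.sum_ite_eq']
    split_ifs with h
    · rfl
    · rw [DFinsupp.notMem_support_iff.1 h]
      rfl
  rw [← key]
  exact Polynomial.aeval_apply_smul_mem_of_le_comap hx P A hU

theorem scale_apply_mem (ℳ : ℤ → Submodule K M) [Decomposition ℳ] (c : ℤ → K) {U : Submodule K M}
    (hU : U.IsHomogeneous ℳ) {u : M} (hu : u ∈ U) : scale ℳ c u ∈ U := by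
  classical
  rw [← sum_support_decompose ℳ u, map_sum]
  refine Submodule.sum_mem _ fun i _ => ?_
  rw [scale_apply_of_mem ℳ c (decompose ℳ u i).2]
  exact U.smul_mem _ (hU i hu)

theorem isSemisimple_scale [FiniteDimensional K M] (ℳ : ℤ → Submodule K M) [Decomposition ℳ]
    {c : ℤ → K} (hc : Function.Injective c) : (scale ℳ c).IsSemisimple := by
  have hfin : {q | ℳ q ≠ ⊥}.Finite :=
    WellFoundedGT.finite_ne_bot_of_iSupIndep (Decomposition.isInternal ℳ).submodule_iSupIndep
  refine Module.End.isSemisimple_of_squarefree_aeval_eq_zero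
    (p := ∏ q ∈ hfin.toFinset, (Polynomial.X - Polynomial.C (c q))) ?_ ?_
  · exact (Polynomial.separable_prod_X_sub_C_iff'.2 fun x _ y _ h => hc h).squarefree
  · refine ext_of_forall_mem ℳ fun p m hm => ?_
    rw [Module.End.aeval_apply_of_mem_apply_eq_smul (scale_apply_of_mem ℳ c hm),
      Polynomial.eval_prod, LinearMap.zero_apply]
    by_cases hp : ℳ p = ⊥
    · rw [hp] at hm
      rw [(Submodule.mem_bot K).1 hm, smul_zero]
    · rw [Finset.prod_eq_zero (hfin.mem_toFinset.2 hp) (by simp), zero_smul]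

theorem scale_scale (ℳ : ℤ → Submodule K M) [Decomposition ℳ] {c d : ℤ → K}
    (h : ∀ p, c p * d p = 1) (m : M) : scale ℳ c (scale ℳ d m) = m := by
  have : scale ℳ c * scale ℳ d = 1 := ext_of_forall_mem ℳ fun p m hm => by
    rw [Module.End.mul_apply, scale_apply_of_mem ℳ d hm, map_smul, scale_apply_of_mem ℳ c hm,
      smul_smul, mul_comm, h, one_smul, Module.End.one_apply]
  exact LinearMap.congr_fun this m

theorem two_zpow_injective [CharZero K] : Function.Injective fun p : ℤ => (2 : K) ^ p := by
  intro p q h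
  have h' : (((2 : ℚ) ^ p : ℚ) : K) = (((2 : ℚ) ^ q : ℚ) : K) := by
    push_cast
    exact h
  exact zpow_right_injective₀ (by norm_num) (by norm_num) (Rat.cast_injective h')

end Scale

/-! ### Homogeneous radical and Levi–Malcev decomposition -/

section Lie

variable {K : Type*} [Field K] {L : Type*} [LieRing L] [LieAlgebra K L]

theorem scale_lie (ℒ : ℤ → Submodule K L) [GradedLieAlgebra ℒ] {c : ℤ → K}
    (hc : ∀ p q, c (p + q) = c p * c q) (x y : L) :
    scale ℒ c ⁅x, y⁆ = ⁅scale ℒ c x, scale ℒ c y⁆ := by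
  induction x using DirectSum.Decomposition.inductionOn ℒ with
  | zero => simp
  | add m m' h h' => rw [map_add, add_lie, add_lie, map_add, h, h']
  | homogeneous x =>
    induction y using DirectSum.Decomposition.inductionOn ℒ with
    | zero => simp
    | add m m' h h' => rw [map_add, lie_add, lie_add, map_add, h, h']
    | homogeneous y =>
      rw [scale_apply_of_mem ℒ c x.2, scale_apply_of_mem ℒ c y.2,
        scale_apply_of_mem ℒ c (SetLike.GradedBracket.bracket_mem x.2 y.2), hc, smul_lie, lie_smul,
        smul_smul]

theorem scale_lie_eq_add (ℒ : ℤ → Submodule K L) [GradedLieAlgebra ℒ] (x y : L) :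
    scale ℒ (fun p => (p : K)) ⁅x, y⁆ =
      ⁅scale ℒ (fun p => (p : K)) x, y⁆ + ⁅x, scale ℒ (fun p => (p : K)) y⁆ := by
  induction x using DirectSum.Decomposition.inductionOn ℒ with
  | zero => simp
  | add m m' h h' => rw [map_add, add_lie, add_lie, map_add, h, h', add_lie]; abel
  | homogeneous x =>
    induction y using DirectSum.Decomposition.inductionOn ℒ with
    | zero => simp
    | add m m' h h' => rw [map_add, lie_add, lie_add, map_add, h, h', lie_add]; abel
    | homogeneous y =>
      rw [scale_apply_of_mem ℒ _ x.2, scale_apply_of_mem ℒ _ y.2,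
        scale_apply_of_mem ℒ _ (SetLike.GradedBracket.bracket_mem x.2 y.2), smul_lie, lie_smul,
        ← add_smul, Int.cast_add]

variable [FiniteDimensional K L]

/-- The preimage of the radical under the injective map `φ` is a solvable ideal. Of `ψ` only `φ ∘ ψ
= id` matters, so it is a bare function. -/
theorem mem_radical_of_rightInverse (φ : L →ₗ⁅K⁆ L) (ψ : L → L) (h : ∀ x, φ (ψ x) = x) {x : L}
    (hx : x ∈ LieAlgebra.radical K L) : ψ x ∈ LieAlgebra.radical K L := by
  let J := (LieAlgebra.radical K L).comap φ
  let i : J →ₗ⁅K⁆ LieAlgebra.radical K L :=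
    { toFun := fun x => ⟨φ x, LieIdeal.mem_comap.1 x.2⟩
      map_add' := fun x y => Subtype.ext (by simp)
      map_smul' := fun c x => Subtype.ext (by simp)
      map_lie' := fun {x y} => Subtype.ext (by simp) }
  have hφ : Function.Injective φ :=
    (LinearMap.injective_iff_surjective (f := (φ : L →ₗ[K] L))).2 fun x => ⟨ψ x, h x⟩
  have : LieAlgebra.IsSolvable J := Function.Injective.lieAlgebra_isSolvable (f := i) fun x y hxy =>
    Subtype.ext (hφ (congrArg (fun z : LieAlgebra.radical K L => (z : L)) hxy))
  have hJ : J ≤ LieAlgebra.radical K L := (LieAlgebra.LieIdeal.solvable_iff_le_radical K L J).1 this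
  exact hJ (LieIdeal.mem_comap.2 (by rwa [h]))

variable [CharZero K]

/-- The radical of a homogeneous subalgebra of a graded Lie algebra is homogeneous. -/
theorem isHomogeneous_map_radical (ℒ : ℤ → Submodule K L) [GradedLieAlgebra ℒ]
    (g : LieSubalgebra K L) (hg : g.toSubmodule.IsHomogeneous ℒ) :
    ((LieAlgebra.radical K g).toSubmodule.map (g.incl : g →ₗ[K] L)).IsHomogeneous ℒ := by
  have h2 : (2 : K) ≠ 0 := two_ne_zero
  -- Scaling degree `p` by `2 ^ p` is an automorphism, and stability of the radical is immediate for
  -- automorphisms, unlike for derivations.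
  refine isHomogeneous_of_forall_apply_mem ℒ (c := fun p => (2 : K) ^ p) two_zpow_injective
    (A := scale ℒ fun p => (2 : K) ^ p) (fun p m hm => scale_apply_of_mem ℒ _ hm) ?_
  let φ : g →ₗ⁅K⁆ g :=
    { (scale ℒ fun p => (2 : K) ^ (-p)).restrict
        (p := g.toSubmodule) (q := g.toSubmodule) (fun x hx => scale_apply_mem ℒ _ hg hx) with
      map_lie' := fun {x y} => Subtype.ext
        (scale_lie ℒ (fun p q => by rw [neg_add, zpow_add₀ h2]) (x : L) y) }
  rintro _ ⟨x, hx, rfl⟩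
  exact ⟨⟨scale ℒ (fun p => (2 : K) ^ p) x, scale_apply_mem ℒ _ hg x.2⟩,
    mem_radical_of_rightInverse φ
      (fun x => ⟨scale ℒ (fun p => (2 : K) ^ p) x, scale_apply_mem ℒ _ hg x.2⟩)
      (fun x => Subtype.ext (scale_scale ℒ (fun p => by rw [← zpow_add₀ h2]; simp) _)) hx, rfl⟩

theorem isHomogeneous_radical (ℒ : ℤ → Submodule K L) [GradedLieAlgebra ℒ] :
    (LieAlgebra.radical K L).toSubmodule.IsHomogeneous ℒ := by
  have h2 : (2 : K) ≠ 0 := two_ne_zero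
  refine isHomogeneous_of_forall_apply_mem ℒ (c := fun p => (2 : K) ^ p) two_zpow_injective
    (A := scale ℒ fun p => (2 : K) ^ p) (fun p m hm => scale_apply_of_mem ℒ _ hm) fun x hx => ?_
  exact mem_radical_of_rightInverse
    { (scale ℒ fun p => (2 : K) ^ (-p)) with
      map_lie' := fun {x y} => scale_lie ℒ (fun p q => by rw [neg_add, zpow_add₀ h2]) x y } _
    (fun x => scale_scale ℒ (fun p => by rw [← zpow_add₀ h2]; simp) x) hx

/-- A Levi-Malcev decomposition stable under a semisimple derivation that preserves the radical. -/
theorem exists_isLeviMalcev {D : Module.End K L} (hss : D.IsSemisimple)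
    (hD : ∀ x y, D ⁅x, y⁆ = ⁅D x, y⁆ + ⁅x, D y⁆)
    (hDr : ∀ x ∈ LieAlgebra.radical K L, D x ∈ LieAlgebra.radical K L) :
    ∃ s : LieSubalgebra K L, IsLeviMalcev s ∧ ∀ x ∈ s, D x ∈ s := by
  set r := LieAlgebra.radical K L with hr
  have : LieAlgebra.IsSolvable (quotientHom r).ker := by
    rw [ker_quotientHom]
    infer_instance
  obtain ⟨s, hsD, hs0, hst⟩ := exists_section_of_ker_isSolvable (quotientHom r)
    (quotientHom_surjective r) hss hD fun x hx => by
      rw [quotientHom_eq_zero] at hx ⊢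
      exact hDr x hx
  let e : (L ⧸ r) ≃ₗ⁅K⁆ s := (LieEquiv.ofBijective ((quotientHom r).comp s.incl)
    ⟨(injective_iff_map_eq_zero _).2 fun x hx => Subtype.ext (hs0 x x.2 hx), fun t => by
      obtain ⟨x, hx, rfl⟩ := hst t
      exact ⟨⟨x, hx⟩, rfl⟩⟩).symm
  have : LieAlgebra.HasTrivialRadical K s := hasTrivialRadical_of_surjective
    (e : (L ⧸ r) →ₗ⁅K⁆ s) e.surjective
  refine ⟨s, ⟨inferInstance, ?_, ?_⟩, hsD⟩
  · rw [Submodule.disjoint_def]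
    exact fun x hx hxr => hs0 x hx ((quotientHom_eq_zero r x).2 hxr)
  · rw [codisjoint_iff, eq_top_iff]
    intro x _
    obtain ⟨y, hy, hyx⟩ := hst (quotientHom r x)
    refine Submodule.mem_sup.2 ⟨y, hy, x - y, ?_, by abel⟩
    exact (quotientHom_eq_zero r _).1 (by rw [map_sub, hyx, sub_self])

theorem exists_isLeviMalcev_isHomogeneous (ℒ : ℤ → Submodule K L) [GradedLieAlgebra ℒ] :
    ∃ s : LieSubalgebra K L, IsLeviMalcev s ∧ s.toSubmodule.IsHomogeneous ℒ := by
  obtain ⟨s, hs, hsD⟩ := exists_isLeviMalcev (isSemisimple_scale ℒ (c := fun p => (p : K))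
    Int.cast_injective) (scale_lie_eq_add ℒ)
    (fun x hx => scale_apply_mem ℒ _ (isHomogeneous_radical ℒ) hx)
  exact ⟨s, hs, isHomogeneous_of_forall_apply_mem ℒ Int.cast_injective
    (fun p m hm => scale_apply_of_mem ℒ _ hm) hsD⟩

end Lie

/-! ### Nilpotent elements of solvable ideals -/

section Nilpotent

open TensorProduct LieModule

theorem toEnd_quotient_pow_mk {K g V : Type*} [Field K] [LieRing g] [LieAlgebra K g]
    [AddCommGroup V] [Module K V] [LieRingModule g V] [LieModule K g V] (U : LieSubmodule K g V)
    (x : g) (k : ℕ) (v : V) : (toEnd K g (V ⧸ U) x ^ k) (LieSubmodule.Quotient.mk' U v)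
      = LieSubmodule.Quotient.mk' U ((toEnd K g V x ^ k) v) := by
  induction k with
  | zero => simp
  | succ k ih =>
    rw [pow_succ', pow_succ', Module.End.mul_apply, Module.End.mul_apply, ih]
    rfl

theorem isNilpotent_toEnd_of_quotient {K g V : Type*} [Field K] [LieRing g] [LieAlgebra K g]
    [AddCommGroup V] [Module K V] [LieRingModule g V] [LieModule K g V] (U : LieSubmodule K g V)
    {x : g} (hq : IsNilpotent (toEnd K g (V ⧸ U) x)) (hU : ∀ u ∈ U, ⁅x, u⁆ = 0) :
    IsNilpotent (toEnd K g V x) := by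
  obtain ⟨k, hk⟩ := hq
  refine ⟨k + 1, LinearMap.ext fun v => ?_⟩
  rw [pow_succ', Module.End.mul_apply]
  refine hU _ ((LieSubmodule.Quotient.mk_eq_zero U).1 ?_)
  rw [← toEnd_quotient_pow_mk, hk, LinearMap.zero_apply]

/-- By Lie's theorem `I` has a nonzero weight space `U`, which is a `g`-submodule. On `U` a bracket
is a scalar of trace zero, hence zero, and a nilpotent element of `I` is a nilpotent scalar, hence
zero. Induction handles `V ⧸ U`. -/
theorem isNilpotent_toEnd_of_isAlgClosed {K g : Type*} [Field K] [CharZero K] [IsAlgClosed K]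
    [LieRing g] [LieAlgebra K g] (I : LieIdeal K g) [LieAlgebra.IsSolvable I] {V : Type*}
    [AddCommGroup V] [Module K V] [LieRingModule g V] [LieModule K g V] [FiniteDimensional K V] :
    (∀ x : g, ∀ y ∈ I, IsNilpotent (toEnd K g V ⁅x, y⁆)) ∧
      ∀ y ∈ I, ∀ z ∈ I, IsNilpotent (toEnd K g V y) → IsNilpotent (toEnd K g V z) →
        IsNilpotent (toEnd K g V (y + z)) := by
  induction hd : Module.finrank K V using Nat.strong_induction_on generalizing V with
  | _ d ih =>
  subst hd
  rcases subsingleton_or_nontrivial V with hV | hV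
  · exact ⟨fun x y _ => ⟨1, Subsingleton.elim _ _⟩, fun y _ z _ _ _ => ⟨1, Subsingleton.elim _ _⟩⟩
  obtain ⟨χ, hχ⟩ := exists_nontrivial_weightSpace_of_isSolvable K I V
  let U : LieSubmodule K g V := weightSpaceOfIsLieTower K V χ
  have hU : ∀ y (hy : y ∈ I), ∀ u ∈ U, ⁅y, u⁆ = χ ⟨y, hy⟩ • u := fun y hy u hu =>
    (mem_weightSpace (χ : I → K) u).1 hu ⟨y, hy⟩
  have hUn : Nontrivial U := hχ
  have hpos : 0 < Module.finrank K U := Module.finrank_pos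
  have hlt : Module.finrank K (V ⧸ U) < Module.finrank K V := by
    have := U.toSubmodule.finrank_quotient_add_finrank
    change Module.finrank K (V ⧸ U) + Module.finrank K U = _ at this
    omega
  obtain ⟨ih1, ih2⟩ := ih _ hlt (V := V ⧸ U) rfl
  have hq : ∀ y, IsNilpotent (toEnd K g V y) → IsNilpotent (toEnd K g (V ⧸ U) y) := by
    rintro y ⟨k, hk⟩
    refine ⟨k, LinearMap.ext fun v => ?_⟩
    obtain ⟨v, rfl⟩ := LieSubmodule.Quotient.surjective_mk' U v
    rw [toEnd_quotient_pow_mk, hk]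
    simp
  have hz : ∀ y ∈ I, IsNilpotent (toEnd K g V y) → ∀ u ∈ U, ⁅y, u⁆ = 0 := by
    rintro y hy ⟨k, hk⟩ u hu
    have h : ∀ k : ℕ, (toEnd K g V y ^ k) u = χ ⟨y, hy⟩ ^ k • u := by
      intro k
      induction k with
      | zero => simp
      | succ k ih =>
        rw [pow_succ', Module.End.mul_apply, ih, map_smul, toEnd_apply_apply, hU y hy u hu,
          smul_smul, pow_succ]
    have h0 := h k
    rw [hk, LinearMap.zero_apply] at h0
    rw [hU y hy u hu]
    rcases smul_eq_zero.1 h0.symm with h1 | h1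
    · rw [eq_zero_of_pow_eq_zero h1, zero_smul]
    · rw [h1, smul_zero]
  refine ⟨fun x y hy => isNilpotent_toEnd_of_quotient U (ih1 x y hy) fun u hu => ?_,
    fun y hy z hzI hyn hzn => isNilpotent_toEnd_of_quotient U
      (ih2 y hy z hzI (hq y hyn) (hq z hzn)) fun u hu => ?_⟩
  · have hxy : ⁅x, y⁆ ∈ I := I.lie_mem hy
    have htr : LinearMap.trace K U (toEnd K g U ⁅x, y⁆) = 0 := by
      rw [LieHom.map_lie, LinearMap.trace_lie]
    have hsc : toEnd K g U ⁅x, y⁆ = χ ⟨⁅x, y⁆, hxy⟩ • LinearMap.id :=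
      LinearMap.ext fun u => Subtype.ext (hU _ hxy u u.2)
    rw [hsc, map_smul, LinearMap.trace_id, smul_eq_mul, mul_eq_zero, Nat.cast_eq_zero] at htr
    rw [hU _ hxy u hu, htr.resolve_right hpos.ne', zero_smul]
  · rw [add_lie, hz y hy hyn u hu, hz z hzI hzn u hu, add_zero]

variable {K : Type*} [Field K] [CharZero K] {V : Type*} [AddCommGroup V] [Module K V]
  [FiniteDimensional K V]

/-- Solvability passes to the algebraic closure, and nilpotency descends because base change of
endomorphisms is injective. -/
theorem isNilpotent_toEnd_of_isSolvable {g : Type*} [LieRing g] [LieAlgebra K g]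
    (I : LieIdeal K g) [LieAlgebra.IsSolvable I] [LieRingModule g V] [LieModule K g V] :
    (∀ x : g, ∀ y ∈ I, IsNilpotent (toEnd K g V ⁅x, y⁆)) ∧
      ∀ y ∈ I, ∀ z ∈ I, IsNilpotent (toEnd K g V y) → IsNilpotent (toEnd K g V z) →
        IsNilpotent (toEnd K g V (y + z)) := by
  let A := AlgebraicClosure K
  have : LieAlgebra.IsSolvable (I.baseChange A) := by
    obtain ⟨k, hk⟩ := LieAlgebra.IsSolvable.solvable K I
    refine LieAlgebra.IsSolvable.mk (R := A) (k := k) ?_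
    rw [LieIdeal.derivedSeries_eq_bot_iff] at hk ⊢
    rw [LieAlgebra.derivedSeriesOfIdeal_baseChange, hk, LieSubmodule.baseChange_bot]
  obtain ⟨h1, h2⟩ := isNilpotent_toEnd_of_isAlgClosed (I.baseChange A) (V := A ⊗[K] V)
  have hinj : Function.Injective (Module.End.baseChangeHom K A V) :=
    LinearMap.baseChangeHom_injective K V A
  have hn : ∀ x : g, IsNilpotent (toEnd A (A ⊗[K] g) (A ⊗[K] V) (1 ⊗ₜ x)) ↔
      IsNilpotent (toEnd K g V x) := fun x => by
    rw [toEnd_baseChange]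
    exact IsNilpotent.map_iff hinj
  have hI : ∀ y ∈ I, (1 : A) ⊗ₜ[K] y ∈ I.baseChange A := fun y hy =>
    Submodule.tmul_mem_baseChange_of_mem 1 hy
  refine ⟨fun x y hy => ?_, fun y hy z hz hyn hzn => ?_⟩
  · rw [← hn]
    simpa using h1 (1 ⊗ₜ x) (1 ⊗ₜ y) (hI y hy)
  · rw [← hn, TensorProduct.tmul_add]
    exact h2 _ (hI y hy) _ (hI z hz) ((hn y).2 hyn) ((hn z).2 hzn)

/-- The element `x` is only required to normalize `r`, so that the degree operator, which need not
lie in `g`, is covered; `r` is viewed as an ideal of its normalizer. -/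
theorem isNilpotent_lie_and_add (r : LieSubalgebra K (Module.End K V)) [LieAlgebra.IsSolvable r] :
    (∀ x : Module.End K V, (∀ y ∈ r, ⁅x, y⁆ ∈ r) → ∀ y ∈ r, IsNilpotent ⁅x, y⁆) ∧
      ∀ y ∈ r, ∀ z ∈ r, IsNilpotent y → IsNilpotent z → IsNilpotent (y + z) := by
  let I : LieIdeal K r.normalizer :=
    { r.toSubmodule.comap (r.normalizer.incl : r.normalizer →ₗ[K] Module.End K V) with
      lie_mem := fun {x m} hm => (LieSubalgebra.mem_normalizer_iff r x.1).1 x.2 _ hm }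
  let i : I →ₗ⁅K⁆ r :=
    { toFun := fun x => ⟨x.1.1, x.2⟩
      map_add' := fun x y => rfl
      map_smul' := fun c x => rfl
      map_lie' := fun {x y} => rfl }
  have : LieAlgebra.IsSolvable I := Function.Injective.lieAlgebra_isSolvable (f := i) fun x y h =>
    Subtype.ext (Subtype.ext (congrArg (fun z : r => (z : Module.End K V)) h))
  obtain ⟨h1, h2⟩ := isNilpotent_toEnd_of_isSolvable (V := V) I
  have hr : ∀ y ∈ r, y ∈ r.normalizer := fun y hy => r.le_normalizer hy
  exact ⟨fun x hx y hy => h1 ⟨x, (LieSubalgebra.mem_normalizer_iff r x).2 hx⟩ ⟨y, hr y hy⟩ hy,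
    fun y hy z hz hyn hzn => h2 ⟨y, hr y hy⟩ hy ⟨z, hr z hz⟩ hz hyn hzn⟩

end Nilpotent

/-! ### Levi–Chevalley decomposition -/

section Chevalley

variable {K : Type*} [Field K] {V : Type*} [AddCommGroup V] [Module K V]

/-- The solvable radical of a Lie subalgebra `g` of `gl(V)`, as a subalgebra of `gl(V)`. -/
def radicalIn (g : LieSubalgebra K (Module.End K V)) : LieSubalgebra K (Module.End K V) :=
  (LieAlgebra.radical K g).toLieSubalgebra.map g.incl

variable {g : LieSubalgebra K (Module.End K V)}

theorem coe_mem_radicalIn {x : g} :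
    (x : Module.End K V) ∈ radicalIn g ↔ x ∈ LieAlgebra.radical K g :=
  ⟨fun ⟨_, hy, hyx⟩ => Subtype.ext hyx ▸ hy, fun h => ⟨x, h, rfl⟩⟩

theorem radicalIn_le : radicalIn g ≤ g := by
  rintro _ ⟨y, -, rfl⟩
  exact y.2

theorem lie_mem_radicalIn {x y : Module.End K V} (hx : x ∈ g) (hy : y ∈ radicalIn g) :
    ⁅x, y⁆ ∈ radicalIn g := by
  obtain ⟨y, hy, rfl⟩ := hy
  exact ⟨⁅(⟨x, hx⟩ : g), y⁆, (LieAlgebra.radical K g).lie_mem hy, rfl⟩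

theorem mem_of_isDecomposable (hg : IsDecomposable g) {S N : Module.End K V} (hS : S.IsSemisimple)
    (hN : IsNilpotent N) (hc : Commute S N) (h : S + N ∈ g) : S ∈ g := by
  rw [← hg]
  exact LieSubalgebra.subset_lieSpan ⟨S, N, hS, hN, hc, h, Or.inl rfl⟩

/-- A Lie algebra is reductive in `V` if invariant subspaces have equivariant projections. -/
theorem isReductiveIn_of_exists_projection (h : LieSubalgebra K (Module.End K V))
    (hp : ∀ U : Submodule K V, (∀ x ∈ h, ∀ u ∈ U, x u ∈ U) →
      ∃ m ∈ scalarOn U, (∀ u ∈ U, m u = u) ∧ ∀ x ∈ h, ⁅x, m⁆ = 0) : IsReductiveIn h := by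
  refine ⟨fun U => ?_⟩
  obtain ⟨m, hm, hid, hx⟩ := hp U.toSubmodule fun x hx u hu => U.lie_mem (x := ⟨x, hx⟩) hu
  refine ⟨{ LinearMap.ker m with
      lie_mem := fun {x v} hv => by
        have h1 := LinearMap.congr_fun (hx x x.2) v
        have hv : m v = 0 := hv
        rw [Ring.lie_def, LinearMap.sub_apply, Module.End.mul_apply, Module.End.mul_apply, hv,
          map_zero, zero_sub, LinearMap.zero_apply, neg_eq_zero] at h1
        exact h1 }, ?_⟩
  rw [← LieSubmodule.isCompl_toSubmodule]
  constructor
  · rw [Submodule.disjoint_def]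
    intro v hv hv0
    have hv0 : m v = 0 := hv0
    rw [← hid v hv, hv0]
  · rw [codisjoint_iff, eq_top_iff]
    intro v _
    refine Submodule.mem_sup.2 ⟨m v, hm.1 v, v - m v, ?_, by abel⟩
    change m (v - m v) = 0
    rw [map_sub, hid _ (hm.1 v), sub_self]

variable [FiniteDimensional K V]

instance isSolvable_radicalIn : LieAlgebra.IsSolvable (radicalIn g) := by
  let i : radicalIn g →ₗ⁅K⁆ LieAlgebra.radical K g :=
    { toFun := fun x => ⟨⟨x, radicalIn_le x.2⟩, coe_mem_radicalIn.1 x.2⟩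
      map_add' := fun x y => rfl
      map_smul' := fun c x => rfl
      map_lie' := fun {x y} => rfl }
  exact Function.Injective.lieAlgebra_isSolvable (f := i) fun x y h =>
    Subtype.ext (congrArg (fun z : LieAlgebra.radical K g => ((z : g) : Module.End K V)) h)

variable [CharZero K]

/-- The radical of a decomposable Lie algebra contains the semisimple components of its elements. -/
theorem mem_radicalIn_of_isDecomposable (hg : IsDecomposable g) {S N : Module.End K V}
    (hS : S.IsSemisimple) (hN : IsNilpotent N) (hc : Commute S N) (h : S + N ∈ radicalIn g) :
    S ∈ radicalIn g := by
  have hSg := mem_of_isDecomposable hg hS hN hc (radicalIn_le h)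
  by_cases h0 : S + N = 0
  · have hS0 : IsNilpotent S := by
      rw [eq_neg_of_add_eq_zero_left h0]
      exact hN.neg
    rw [Module.End.eq_zero_of_isNilpotent_isSemisimple hS0 hS]
    exact zero_mem _
  -- `ad S` is a polynomial in `ad (S + N)`. Both kill `S + N ≠ 0`, so the constant term vanishes,
  -- and `⁅S, y⁆` is obtained from `⁅S + N, y⁆` by operators preserving the radical.
  obtain ⟨p, hp⟩ := Algebra.adjoin_mem_exists_aeval K _
    (LieAlgebra.ad_mem_adjoin_of_isSemisimple hc.symm hN hS)
  rw [add_comm] at hp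
  have key : ∀ y, ⁅S, y⁆ = p.coeff 0 • y +
      Polynomial.aeval (LieAlgebra.ad K _ (S + N)) p.divX ⁅S + N, y⁆ := by
    intro y
    have h1 := LinearMap.congr_fun hp y
    rw [← Polynomial.divX_mul_X_add p, map_add, map_mul, Polynomial.aeval_X, Polynomial.aeval_C,
      LinearMap.add_apply, Module.End.mul_apply, LieAlgebra.ad_apply, LieAlgebra.ad_apply,
      Module.algebraMap_end_apply] at h1
    rw [← h1, add_comm]
  have hp0 : p.coeff 0 = 0 := by
    have h1 := key (S + N)
    rw [lie_self, map_zero, add_zero, lie_add, lie_self, zero_add, hc.lie_eq] at h1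
    exact (smul_eq_zero.1 h1.symm).resolve_right h0
  have hmem : ∀ y ∈ g, ⁅S, y⁆ ∈ radicalIn g := by
    intro y hy
    rw [key, hp0, zero_smul, zero_add]
    refine Polynomial.aeval_apply_smul_mem_of_le_comap (q := (radicalIn g).toSubmodule) ?_ _ _
      fun z hz => lie_mem_radicalIn (radicalIn_le h) hz
    rw [← lie_skew]
    exact neg_mem (lie_mem_radicalIn hy h)
  -- Thus `S` is central modulo the radical, and the semisimple quotient has trivial center.
  have hz : quotientHom (LieAlgebra.radical K g) ⟨S, hSg⟩
      ∈ LieAlgebra.center K (g ⧸ LieAlgebra.radical K g) := by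
    rw [LieModule.mem_maxTrivSubmodule]
    intro y
    obtain ⟨y, rfl⟩ := quotientHom_surjective _ y
    rw [← LieHom.map_lie, quotientHom_eq_zero, ← lie_skew]
    exact neg_mem (coe_mem_radicalIn.1 (hmem y y.2))
  rw [LieAlgebra.center_eq_bot, LieSubmodule.mem_bot, quotientHom_eq_zero] at hz
  exact coe_mem_radicalIn.2 hz

/-- The elements of the solvable radical of `g` that are nilpotent endomorphisms form an ideal. -/
def nilpotentIdeal (g : LieSubalgebra K (Module.End K V)) : LieIdeal K g where
  carrier := {x | x ∈ LieAlgebra.radical K g ∧ IsNilpotent (x : Module.End K V)}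
  add_mem' := fun {x y} hx hy => ⟨add_mem hx.1 hy.1, (isNilpotent_lie_and_add (radicalIn g)).2 x
    (coe_mem_radicalIn.2 hx.1) y (coe_mem_radicalIn.2 hy.1) hx.2 hy.2⟩
  zero_mem' := ⟨zero_mem _, IsNilpotent.zero⟩
  smul_mem' := fun c _ hx => ⟨Submodule.smul_mem _ c hx.1, hx.2.smul c⟩
  lie_mem := fun {x y} hy => ⟨(LieAlgebra.radical K g).lie_mem hy.1,
    (isNilpotent_lie_and_add (radicalIn g)).1 x (fun _ hz => lie_mem_radicalIn x.2 hz) y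
      (coe_mem_radicalIn.2 hy.1)⟩

/-- The elements of the solvable radical of `g` that are nilpotent endomorphisms, as a subspace
of `gl(V)`. -/
def nilpotentIn (g : LieSubalgebra K (Module.End K V)) : Submodule K (Module.End K V) :=
  (nilpotentIdeal g).toSubmodule.map (g.incl : g →ₗ[K] Module.End K V)

theorem mem_nilpotentIn {x : Module.End K V} :
    x ∈ nilpotentIn g ↔ x ∈ radicalIn g ∧ IsNilpotent x := by
  constructor
  · rintro ⟨y, hy, rfl⟩
    exact ⟨coe_mem_radicalIn.2 hy.1, hy.2⟩
  · rintro ⟨⟨y, hy, rfl⟩, hn⟩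
    exact ⟨y, ⟨hy, hn⟩, rfl⟩

theorem lie_mem_nilpotentIn {x y : Module.End K V} (hx : ∀ z ∈ radicalIn g, ⁅x, z⁆ ∈ radicalIn g)
    (hy : y ∈ radicalIn g) : ⁅x, y⁆ ∈ nilpotentIn g :=
  mem_nilpotentIn.2 ⟨hx y hy, (isNilpotent_lie_and_add (radicalIn g)).1 x hx y hy⟩

/-- Equivariant representatives modulo `N` for the adjoint action of a commuting set of semisimple
endomorphisms. -/
theorem exists_mem_inf_forall_lie_sub_eq_zero (t : Set (Module.End K V))
    (hcomm : ∀ a ∈ t, ∀ b ∈ t, Commute a b) (hss : ∀ a ∈ t, a.IsSemisimple)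
    (N c : Submodule K (Module.End K V)) (hc : ∀ a ∈ t, ∀ x ∈ c, ⁅a, x⁆ ∈ c)
    (hN : ∀ a ∈ t, ∀ x ∈ c, ⁅a, x⁆ ∈ N) {x : Module.End K V} (hx : x ∈ c) :
    ∃ n ∈ c ⊓ N, ∀ a ∈ t, ⁅a, x - n⁆ = 0 := by
  obtain ⟨n, hn, hn'⟩ := exists_mem_inf_forall_apply_sub_eq_zero_of_isSemisimple
    ((LieAlgebra.ad K (Module.End K V)) '' t)
    (by
      rintro _ ⟨a, ha, rfl⟩ _ ⟨b, hb, rfl⟩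
      exact LieAlgebra.commute_ad_of_commute (hcomm a ha b hb))
    (by
      rintro _ ⟨a, ha, rfl⟩
      exact LieAlgebra.ad_isSemisimple_of_isSemisimple (hss a ha)) N c
    (by
      rintro _ ⟨a, ha, rfl⟩ w hw
      exact hc a ha w hw)
    (by
      rintro _ ⟨a, ha, rfl⟩ w hw
      exact hN a ha w hw) hx
  exact ⟨n, hn, fun a ha => hn' _ ⟨a, ha, rfl⟩⟩

/-- A maximal commutative subspace of semisimple endomorphisms of `c` contains every semisimple
element of `c` that commutes with it. -/
theorem exists_maximal_torus (c : Submodule K (Module.End K V)) :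
    ∃ t ≤ c, (∀ a ∈ t, ∀ b ∈ t, Commute a b) ∧ (∀ a ∈ t, a.IsSemisimple) ∧
      ∀ S ∈ c, S.IsSemisimple → (∀ a ∈ t, Commute a S) → S ∈ t := by
  obtain ⟨t, ⟨htc, hcomm, hss⟩, hmax⟩ := wellFounded_gt.has_min
    {t : Submodule K (Module.End K V) | t ≤ c ∧ (∀ a ∈ t, ∀ b ∈ t, Commute a b) ∧
      ∀ a ∈ t, a.IsSemisimple}
    ⟨⊥, bot_le, fun a ha b _ => by rw [(Submodule.mem_bot K).1 ha]; exact Commute.zero_left b,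
      fun a ha => by rw [(Submodule.mem_bot K).1 ha]; exact Module.End.isSemisimple_zero⟩
  refine ⟨t, htc, hcomm, hss, fun S hSc hSs hSt => ?_⟩
  by_contra hnS
  refine hmax (t ⊔ K ∙ S) ⟨sup_le htc ((Submodule.span_singleton_le_iff_mem _ _).2 hSc), ?_, ?_⟩
    (lt_of_le_not_ge le_sup_left fun h =>
      hnS (h (Submodule.mem_sup_right (Submodule.mem_span_singleton_self S))))
  · intro a ha b hb
    obtain ⟨a, ha₁, u, hu, rfl⟩ := Submodule.mem_sup.1 ha
    obtain ⟨b, hb₁, v, hv, rfl⟩ := Submodule.mem_sup.1 hb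
    obtain ⟨p, rfl⟩ := Submodule.mem_span_singleton.1 hu
    obtain ⟨q, rfl⟩ := Submodule.mem_span_singleton.1 hv
    exact ((hcomm a ha₁ b hb₁).add_right ((hSt a ha₁).smul_right q)).add_left
      (((hSt b hb₁).symm.smul_left p).add_right (((Commute.refl S).smul_left p).smul_right q))
  · intro a ha
    obtain ⟨a, ha₁, u, hu, rfl⟩ := Submodule.mem_sup.1 ha
    obtain ⟨p, rfl⟩ := Submodule.mem_span_singleton.1 hu
    exact (hss a ha₁).add_of_commute ((hSt a ha₁).smul_right p) (Module.End.IsSemisimple_smul p hSs)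

/-- A space of endomorphisms closed under brackets and semisimple components is the sum of a
commutative space of semisimple endomorphisms and of any subspace `N` containing its nilpotent
elements and its brackets. -/
theorem exists_torus (c N : Submodule K (Module.End K V)) (hlie : ∀ x ∈ c, ∀ y ∈ c, ⁅x, y⁆ ∈ c)
    (hJ : ∀ S T : Module.End K V, S.IsSemisimple → IsNilpotent T → Commute S T → S + T ∈ c → S ∈ c)
    (hlieN : ∀ x ∈ c, ∀ y ∈ c, ⁅x, y⁆ ∈ N) (hN : ∀ x ∈ c, IsNilpotent x → x ∈ N) :
    ∃ t ≤ c, (∀ a ∈ t, ∀ b ∈ t, Commute a b) ∧ (∀ a ∈ t, a.IsSemisimple) ∧ c ≤ t ⊔ N := by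
  obtain ⟨t, htc, hcomm, hss, hmax⟩ := exists_maximal_torus c
  refine ⟨t, htc, hcomm, hss, fun x hx => ?_⟩
  obtain ⟨n, hn, hn'⟩ := exists_mem_inf_forall_lie_sub_eq_zero (t : Set (Module.End K V)) hcomm hss
    N c (fun a ha => hlie a (htc ha)) (fun a ha => hlieN a (htc ha)) hx
  -- The corrected `x - n` commutes with `t`, hence so does its semisimple part, a polynomial in it;
  -- maximality puts that part in `t`. The nilpotent part falls into `N`.
  obtain ⟨T, hT, S, hS, hTn, hSs, hTS⟩ := (x - n).exists_isNilpotent_isSemisimple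
  have hy : x - n ∈ c := sub_mem hx hn.1
  have hST : Commute S T := Algebra.commute_of_mem_adjoin_singleton_of_commute hT
    (Algebra.commute_of_mem_adjoin_self hS).symm
  have hSc : S ∈ c := hJ S T hSs hTn hST (by rwa [add_comm, ← hTS])
  have hTc : T ∈ c := by
    rw [eq_sub_of_add_eq hTS.symm]
    exact sub_mem hy hSc
  have hSt : S ∈ t := hmax S hSc hSs fun a ha =>
    Algebra.commute_of_mem_adjoin_singleton_of_commute hS (commute_iff_lie_eq.2 (hn' a ha))
  have hx' : x = S + (T + n) := by
    rw [← add_assoc, add_comm S T, ← hTS, sub_add_cancel]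
  rw [hx']
  exact Submodule.add_mem_sup hSt (add_mem (hN T hTc hTn) hn.2)

/-- The sum of a semisimple Lie algebra and of a commuting commutative space of semisimple
endomorphisms is reductive in `V`. -/
theorem isReductiveIn_of_semisimple_of_torus {S : Type*} [LieRing S] [LieAlgebra K S]
    [FiniteDimensional K S] [LieAlgebra.HasTrivialRadical K S] (ρ : S →ₗ⁅K⁆ Module.End K V)
    (t : Set (Module.End K V)) (hcomm : ∀ a ∈ t, ∀ b ∈ t, Commute a b)
    (hss : ∀ a ∈ t, a.IsSemisimple) (hρ : ∀ x, ∀ a ∈ t, ⁅ρ x, a⁆ = 0)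
    (h : LieSubalgebra K (Module.End K V)) (hS : ∀ x, ρ x ∈ h) (ht : ∀ a ∈ t, a ∈ h)
    (hh : ∀ x ∈ h, ∃ y, ∃ a ∈ t, x = ρ y + a) : IsReductiveIn h := by
  refine isReductiveIn_of_exists_projection h fun U hU => ?_
  obtain ⟨m₀, hm₀, hid₀, hx₀⟩ := exists_mem_scalarOn_forall_commute
    (LieHom.id : S →ₗ⁅K⁆ S) Function.surjective_id ρ
    (fun x hx => by rw [show x = 0 from hx, map_zero]) U fun x => hU _ (hS x)
  -- Since `t` commutes with `ρ`, it acts on the `ρ`-equivariant candidates, so the projection can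
  -- be made `t`-equivariant without losing `ρ`-equivariance.
  let W : Submodule K (Module.End K V) :=
    scalarOn U ⊓ ⨅ x, LinearMap.ker (LieAlgebra.ad K (Module.End K V) (ρ x))
  have hW : ∀ A, A ∈ W ↔ A ∈ scalarOn U ∧ ∀ x, ⁅ρ x, A⁆ = 0 := fun A => by
    simp [W, Submodule.mem_inf, Submodule.mem_iInf]
  obtain ⟨n, hn, hn'⟩ := exists_mem_inf_forall_lie_sub_eq_zero t hcomm hss (zeroOn U) W
    (fun a ha A hA => by
      rw [hW] at hA ⊢
      refine ⟨(lie_mem_scalarOn (hU a (ht a ha)) hA.1).1, fun x => ?_⟩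
      rw [leibniz_lie, hρ x a ha, hA.2, zero_lie, lie_zero, add_zero])
    (fun a ha A hA => (lie_mem_scalarOn (hU a (ht a ha)) ((hW A).1 hA).1).2)
    ((hW m₀).2 ⟨hm₀, hx₀⟩)
  have hm := (hW _).1 (sub_mem ((hW m₀).2 ⟨hm₀, hx₀⟩) hn.1)
  refine ⟨m₀ - n, hm.1, fun u hu => ?_, fun x hx => ?_⟩
  · rw [LinearMap.sub_apply, hid₀ u hu, hn.2 u hu, sub_zero]
  · obtain ⟨y, a, ha, rfl⟩ := hh x hx
    rw [add_lie, hm.2 y, zero_add]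
    exact hn' a ha

/-- The radical is spanned by the nilpotent ideal and by the elements that commute with a
semisimple subalgebra `s` and with a semisimple endomorphism `E` normalizing `s`. -/
theorem radicalIn_le_sup {E : Module.End K V} (hE : E.IsSemisimple)
    (hEr : ∀ x ∈ radicalIn g, ⁅E, x⁆ ∈ radicalIn g) (s : LieSubalgebra K g)
    [LieAlgebra.HasTrivialRadical K s] (hEs : ∀ a ∈ s, ∃ b ∈ s, ⁅E, (a : Module.End K V)⁆ = b)
    (c : Submodule K (Module.End K V)) (hc : ∀ x, x ∈ c ↔ x ∈ radicalIn g ∧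
      (∀ a ∈ s, ⁅(a : Module.End K V), x⁆ = 0) ∧ ⁅E, x⁆ = 0) :
    (radicalIn g).toSubmodule ≤ c ⊔ nilpotentIn g := by
  intro x hx
  obtain ⟨n, hn, hn'⟩ := exists_mem_inf_forall_apply_sub_eq_zero (LieHom.id : s →ₗ⁅K⁆ s)
    Function.surjective_id ((LieAlgebra.ad K (Module.End K V)).comp (g.incl.comp s.incl))
    (nilpotentIn g) (radicalIn g).toSubmodule
    (fun a w hw => lie_mem_radicalIn a.1.2 hw)
    (fun a w hw => lie_mem_nilpotentIn (fun z hz => lie_mem_radicalIn a.1.2 hz) hw)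
    (fun a ha w _ => by rw [show a = 0 from ha, map_zero, LinearMap.zero_apply]) hx
  -- The centralizer of `s` in the radical is stable under `ad E` because `E` normalizes `s`; the
  -- second correction, for `E`, stays inside it.
  let W : Submodule K (Module.End K V) := (radicalIn g).toSubmodule ⊓
    ⨅ a : s, LinearMap.ker (LieAlgebra.ad K (Module.End K V) (a : g))
  have hW : ∀ A, A ∈ W ↔ A ∈ radicalIn g ∧ ∀ a ∈ s, ⁅(a : Module.End K V), A⁆ = 0 := fun A => by
    simp [W, Submodule.mem_inf, Submodule.mem_iInf]
  obtain ⟨n', hn₁, hn₂⟩ := exists_mem_inf_forall_lie_sub_eq_zero {E}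
    (by rintro _ rfl _ rfl; exact Commute.refl _) (by rintro _ rfl; exact hE) (nilpotentIn g) W
    (by
      rintro _ rfl A hA
      rw [hW] at hA ⊢
      refine ⟨hEr A hA.1, fun a ha => ?_⟩
      obtain ⟨b, hb, hab⟩ := hEs a ha
      rw [leibniz_lie, ← lie_skew (a : Module.End K V), hab, neg_lie, hA.2 b hb, hA.2 a ha,
        lie_zero, neg_zero, add_zero])
    (by
      rintro _ rfl A hA
      exact lie_mem_nilpotentIn hEr ((hW A).1 hA).1)
    (x := x - n) ((hW _).2 ⟨sub_mem hx hn.1, fun a ha => hn' ⟨a, ha⟩⟩)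
  have hy := (hW _).1 (sub_mem ((hW (x - n)).2 ⟨sub_mem hx hn.1, fun a ha => hn' ⟨a, ha⟩⟩) hn₁.1)
  have hxe : x = (x - n - n') + (n' + n) := by abel
  rw [hxe]
  exact Submodule.add_mem_sup ((hc _).2 ⟨hy.1, hy.2, hn₂ _ rfl⟩) (add_mem hn₁.2 hn.2)

/-- A Levi-Chevalley decomposition stable under a semisimple endomorphism that normalizes `g` and
its radical. -/
theorem exists_isLeviChevalley (hg : IsDecomposable g) {E : Module.End K V} (hE : E.IsSemisimple)
    (hEg : ∀ x ∈ g, ⁅E, x⁆ ∈ g) (hEr : ∀ x ∈ radicalIn g, ⁅E, x⁆ ∈ radicalIn g) :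
    ∃ (l : LieSubalgebra K g) (n : LieIdeal K g), IsLeviChevalley g l n ∧
      (∀ x ∈ l.map g.incl, ⁅E, x⁆ ∈ l.map g.incl) ∧
      ∀ x ∈ n.toSubmodule.map (g.incl : g →ₗ[K] Module.End K V),
        ⁅E, x⁆ ∈ n.toSubmodule.map (g.incl : g →ₗ[K] Module.End K V) := by
  have hEss : (LieAlgebra.ad K (Module.End K V) E).IsSemisimple :=
    LieAlgebra.ad_isSemisimple_of_isSemisimple hE
  obtain ⟨s, hs, hsD⟩ := exists_isLeviMalcev (L := g)
    (D := (LieAlgebra.ad K (Module.End K V) E).restrict (p := g.toSubmodule) (q := g.toSubmodule)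
      hEg)
    (hEss.restrict ((Module.End.mem_invtSubmodule_iff_forall_mem_of_mem _).2 hEg))
    (fun x y => Subtype.ext (leibniz_lie E (x : Module.End K V) (y : Module.End K V)))
    (fun x hx => coe_mem_radicalIn.1 (hEr x (coe_mem_radicalIn.2 hx)))
  have := hs.semisimple
  have hEs : ∀ a ∈ s, ∃ b ∈ s, ⁅E, (a : Module.End K V)⁆ = b := fun a ha => ⟨_, hsD a ha, rfl⟩
  let c : Submodule K (Module.End K V) := (radicalIn g).toSubmodule ⊓
    (⨅ a : s, LinearMap.ker (LieAlgebra.ad K (Module.End K V) (a : g))) ⊓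
      LinearMap.ker (LieAlgebra.ad K (Module.End K V) E)
  have hc : ∀ x, x ∈ c ↔ x ∈ radicalIn g ∧
      (∀ a ∈ s, ⁅(a : Module.End K V), x⁆ = 0) ∧ ⁅E, x⁆ = 0 := fun x => by
    simp [c, Submodule.mem_inf, Submodule.mem_iInf, and_assoc]
  obtain ⟨t, htc, hcomm, hss, hct⟩ := exists_torus c (nilpotentIn g)
    (fun x hx y hy => by
      rw [hc] at hx hy ⊢
      refine ⟨(radicalIn g).lie_mem hx.1 hy.1, fun a ha => ?_, ?_⟩
      · rw [leibniz_lie, hx.2.1 a ha, hy.2.1 a ha, zero_lie, lie_zero, add_zero]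
      · rw [leibniz_lie, hx.2.2, hy.2.2, zero_lie, lie_zero, add_zero])
    (fun S T hS hT hST h => by
      rw [hc] at h ⊢
      -- By uniqueness of the Jordan–Chevalley decomposition `S` is a polynomial in `S + T`, so it
      -- commutes with whatever `S + T` commutes with.
      obtain ⟨T', hT', S', hS', hTn', hSs', hTS'⟩ := (S + T).exists_isNilpotent_isSemisimple
      have hcm : Commute T' S' := Algebra.commute_of_mem_adjoin_singleton_of_commute hS'
        (Algebra.commute_of_mem_adjoin_self hT').symm
      have hSS' : S = S' := (Module.End.isNilpotent_isSemisimple_unique hT hS hTn' hSs' hST.symm hcm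
        (by rw [add_comm, hTS'])).2
      rw [← hSS'] at hS'
      have hcom : ∀ a : Module.End K V, ⁅a, S + T⁆ = 0 → ⁅a, S⁆ = 0 := fun a ha =>
        commute_iff_lie_eq.1 (Algebra.commute_of_mem_adjoin_singleton_of_commute hS'
          (commute_iff_lie_eq.2 ha))
      exact ⟨mem_radicalIn_of_isDecomposable hg hS hT hST h.1, fun a ha => hcom _ (h.2.1 a ha),
        hcom E h.2.2⟩)
    (fun x hx y hy => lie_mem_nilpotentIn
      (fun z hz => lie_mem_radicalIn (radicalIn_le ((hc x).1 hx).1) hz) ((hc y).1 hy).1)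
    (fun x hx hn => mem_nilpotentIn.2 ⟨((hc x).1 hx).1, hn⟩)
  have hrc := radicalIn_le_sup hE hEr s hEs c hc
  have htr : ∀ a ∈ t, a ∈ radicalIn g := fun a ha => ((hc a).1 (htc ha)).1
  have hst : ∀ a ∈ s, ∀ b : g, (b : Module.End K V) ∈ t → ⁅a, b⁆ = 0 := fun a ha b hb =>
    Subtype.ext (((hc b).1 (htc hb)).2.1 a ha)
  let l : LieSubalgebra K g :=
    { s.toSubmodule ⊔ t.comap (g.incl : g →ₗ[K] Module.End K V) with
      lie_mem' := fun {x y} hx hy => by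
        obtain ⟨a, ha, b, hb, rfl⟩ := Submodule.mem_sup.1 hx
        obtain ⟨a', ha', b', hb', rfl⟩ := Submodule.mem_sup.1 hy
        have h1 : ⁅b, a'⁆ = 0 := by rw [← lie_skew, hst a' ha' b hb, neg_zero]
        have h2 : ⁅b, b'⁆ = 0 := Subtype.ext (hcomm _ hb _ hb').lie_eq
        rw [add_lie, lie_add, lie_add, hst a ha b' hb', h1, h2, add_zero, add_zero, add_zero]
        exact Submodule.mem_sup_left (s.lie_mem ha ha') }
  have hl : ∀ x, x ∈ l ↔ ∃ a ∈ s, ∃ b : g, (b : Module.End K V) ∈ t ∧ a + b = x := fun x =>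
    Submodule.mem_sup
  refine ⟨l, nilpotentIdeal g, ⟨?_, fun X => Iff.rfl, ?_, ?_⟩, ?_, ?_⟩
  · refine isReductiveIn_of_semisimple_of_torus (g.incl.comp s.incl) t hcomm hss
      (fun x a ha => ((hc a).1 (htc ha)).2.1 x x.2) _ (fun x => ?_) (fun a ha => ?_) ?_
    · exact ⟨x, (hl _).2 ⟨x, x.2, 0, zero_mem _, add_zero _⟩, rfl⟩
    · exact ⟨⟨a, radicalIn_le (htr a ha)⟩, (hl _).2 ⟨0, zero_mem _, _, ha, zero_add _⟩, rfl⟩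
    · rintro _ ⟨x, hx, rfl⟩
      obtain ⟨a, ha, b, hb, rfl⟩ := (hl x).1 hx
      exact ⟨⟨a, ha⟩, b, hb, rfl⟩
  · rw [Submodule.disjoint_def]
    intro x hx hxn
    obtain ⟨a, ha, b, hb, rfl⟩ := (hl x).1 hx
    have hbr : b ∈ LieAlgebra.radical K g := coe_mem_radicalIn.1 (htr _ hb)
    -- Both `b` and `a + b` lie in the radical, so `a ∈ s ∩ r = 0`; what remains is both semisimple
    -- and nilpotent.
    have har : a ∈ LieAlgebra.radical K g := by
      have := sub_mem hxn.1 hbr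
      rwa [add_sub_cancel_right] at this
    have ha0 : a = 0 := Submodule.disjoint_def.1 hs.isCompl.disjoint a ha har
    rw [ha0, zero_add] at hxn ⊢
    exact Subtype.ext (Module.End.eq_zero_of_isNilpotent_isSemisimple hxn.2 (hss b hb))
  · rw [codisjoint_iff, eq_top_iff]
    intro x _
    obtain ⟨a, ha, y, hy, rfl⟩ := Submodule.mem_sup.1
      (hs.isCompl.sup_eq_top ▸ Submodule.mem_top : x ∈ _ ⊔ (LieAlgebra.radical K g).toSubmodule)
    obtain ⟨u, hu, v, hv, huv⟩ := Submodule.mem_sup.1 (hrc (coe_mem_radicalIn.2 hy))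
    obtain ⟨b, hb, w, hw, rfl⟩ := Submodule.mem_sup.1 (hct hu)
    obtain ⟨z, hz, hzv⟩ := add_mem hw hv
    refine Submodule.mem_sup.2 ⟨a + ⟨b, radicalIn_le (htr b hb)⟩, (hl _).2 ⟨a, ha, _, hb, rfl⟩, z,
      hz, ?_⟩
    rw [add_assoc]
    congr 1
    refine Subtype.ext ?_
    have hzv : (z : Module.End K V) = w + v := hzv
    change b + (z : Module.End K V) = y
    rw [hzv, ← huv, add_assoc]
  · rintro _ ⟨x, hx, rfl⟩
    obtain ⟨a, ha, b, hb, rfl⟩ := (hl x).1 hx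
    -- The torus was chosen inside the centralizer of `E`, so only the component in `s` contributes.
    refine ⟨_, (hl _).2 ⟨_, hsD a ha, 0, zero_mem _, add_zero _⟩, ?_⟩
    have h1 : ⁅E, (b : Module.End K V)⁆ = 0 := ((hc b).1 (htc hb)).2.2
    change ⁅E, (a : Module.End K V)⁆ = ⁅E, (a : Module.End K V) + b⁆
    rw [lie_add, h1, add_zero]
  · intro x hx
    exact lie_mem_nilpotentIn hEr (mem_nilpotentIn.1 hx).1

end Chevalley

/-! ### The degree operator on `gl(V)` -/

section Graded

variable {K : Type*} [Field K] {V : Type*} [AddCommGroup V] [Module K V]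

theorem lie_scale_of_mem_glGrading (𝒱 : ℤ → Submodule K V) [DirectSum.Decomposition 𝒱] (p : ℤ)
    (A : Module.End K V) (hA : A ∈ glGrading 𝒱 p) :
    ⁅scale 𝒱 (fun q => (q : K)), A⁆ = (p : K) • A := by
  refine ext_of_forall_mem 𝒱 fun q v hv => ?_
  rw [Ring.lie_def, LinearMap.sub_apply, Module.End.mul_apply, Module.End.mul_apply,
    scale_apply_of_mem 𝒱 _ hv, scale_apply_of_mem 𝒱 _ (hA q v hv), map_smul, LinearMap.smul_apply,
    ← sub_smul, Int.cast_add, add_sub_cancel_left]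

/-- `ad` of the degree operator of `V` is the degree operator of `gl(V)`, as the two agree on
homogeneous endomorphisms. -/
theorem lie_scale_mem [FiniteDimensional K V] (𝒱 : ℤ → Submodule K V) [DirectSum.Decomposition 𝒱]
    {U : Submodule K (Module.End K V)} (hU : U.IsHomogeneous (glGrading 𝒱)) {A : Module.End K V}
    (hA : A ∈ U) : ⁅scale 𝒱 (fun q => (q : K)), A⁆ ∈ U := by
  have h : LieAlgebra.ad K (Module.End K V) (scale 𝒱 fun q => (q : K))
      = scale (glGrading 𝒱) fun q => (q : K) := ext_of_forall_mem (glGrading 𝒱) fun p B hB => by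
    rw [LieAlgebra.ad_apply, lie_scale_of_mem_glGrading 𝒱 p B hB, scale_apply_of_mem _ _ hB]
  rw [← LieAlgebra.ad_apply K, h]
  exact scale_apply_mem _ _ hU hA

end Graded

end GradedLevi

theorem mainTheorem1 (K : Type*) [Field K] [CharZero K] :
    (∀ (L : Type*) [LieRing L] [LieAlgebra K L] [FiniteDimensional K L]
      (ℒ : ℤ → Submodule K L) [GradedLieAlgebra ℒ],
      ∃ s : LieSubalgebra K L, GradedLevi.IsLeviMalcev s ∧
        s.toSubmodule.IsHomogeneous ℒ ∧
        (LieAlgebra.radical K L).toSubmodule.IsHomogeneous ℒ) ∧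
    (∀ (V : Type*) [AddCommGroup V] [Module K V] [FiniteDimensional K V]
      (𝒱 : ℤ → Submodule K V) [DirectSum.Decomposition 𝒱]
      (g : LieSubalgebra K (Module.End K V)),
      g.toSubmodule.IsHomogeneous (GradedLevi.glGrading 𝒱) →
      GradedLevi.IsDecomposable g →
      ∃ (l : LieSubalgebra K g) (n : LieIdeal K g), GradedLevi.IsLeviChevalley g l n ∧
        (l.map g.incl).toSubmodule.IsHomogeneous (GradedLevi.glGrading 𝒱) ∧
        (n.toSubmodule.map (g.incl : g →ₗ[K] Module.End K V)).IsHomogeneous (GradedLevi.glGrading 𝒱)) := by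
  refine ⟨fun L _ _ _ ℒ _ => ?_, fun V _ _ _ 𝒱 _ g hg hdec => ?_⟩
  · obtain ⟨s, hs, hsh⟩ := GradedLevi.exists_isLeviMalcev_isHomogeneous ℒ
    exact ⟨s, hs, hsh, GradedLevi.isHomogeneous_radical ℒ⟩
  · obtain ⟨l, n, hln, hl, hn⟩ := GradedLevi.exists_isLeviChevalley hdec
      (GradedLevi.isSemisimple_scale 𝒱 (c := fun q => (q : K)) Int.cast_injective)
      (fun x hx => GradedLevi.lie_scale_mem 𝒱 hg hx)
      (fun x hx => GradedLevi.lie_scale_mem 𝒱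
        (GradedLevi.isHomogeneous_map_radical (GradedLevi.glGrading 𝒱) g hg) hx)
    exact ⟨l, n, hln,
      GradedLevi.isHomogeneous_of_forall_apply_mem (GradedLevi.glGrading 𝒱) Int.cast_injective
        (A := LieAlgebra.ad K _ (GradedLevi.scale 𝒱 fun q => (q : K)))
        (GradedLevi.lie_scale_of_mem_glGrading 𝒱) hl,
      GradedLevi.isHomogeneous_of_forall_apply_mem (GradedLevi.glGrading 𝒱) Int.cast_injective
        (A := LieAlgebra.ad K _ (GradedLevi.scale 𝒱 fun q => (q : K)))
        (GradedLevi.lie_scale_of_mem_glGrading 𝒱) hn⟩
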